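/- Let $E$ be a finite-dimensional complex normed space, i.e. $E=\mathbb{C}^n$ with an arbitrary norm. For a function $f$ holomorphic near $0$ let $P_j^f=\frac{1}{j!}\hat d^{\,j}f(0)$ denote its $j$-homogeneous Taylor polynomial at $0$, and put $\|P\|=\sup_{\|x\|\le 1}|P(x)|$. For $k\in(1,\infty]$ and $\rho>0$ set $$\|f\|_{k,\rho}=\sum_{j=0}^\infty \rho^{-j}\Big(\frac{j}{ke}\Big)^{j/k}\|P_j^f\|,$$ where the factor $(j/(ke))^{j/k}$ is read as $1$ if $k=\infty$ or $j=0$. For $A\in[0,\infty)$ let $Exp^k_{0,A}(E)$ be the space of all $f$ with $\|f\|_{k,\rho}<\infty$ for every $\rho>A$, where $f$ ranges over the entire functions on $E$ if $k<\infty$, and over the holomorphic functions on the open ball $\{x:\|x\|<1/A\}$ (all of $E$ if $A=0$) if $k=\infty$; it carries the locally convex topology generated by the norms $\|\cdot\|_{k,\rho}$, $\rho>A$. Write $Exp^k_0(E)=Exp^k_{0,0}(E)$, and let $\mathcal H(E)$ be the space of entire functions on $E$ with the compact-open topology. A convolution operator on one of these spaces is a continuous linear map $L$ of the space into itself with $d(Lf)(\cdot)a=L(df(\cdot)a)$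 for all $a\in E$ and all $f$; it is nontrivial if it is not a scalar multiple of the identity. A continuous linear operator $T$ on $X$ is mixing if for all non-empty open $U,V\subset X$ there is $n_0$ with $T^n(U)\cap V\ne\emptyset$ for all $n\ge n_0$, and hypercyclic if some orbit $\{x,Tx,T^2x,\dots\}$ is dense in $X$. Then: (a) For every $k\in(1,\infty]$ and $A\in[0,\infty)$, every nontrivial convolution operator on $Exp^k_{0,A}(E)$ is mixing. (b) $Exp^\infty_{0}(E)=\mathcal H(E)$ as topological vector spaces, and (Godefroy--Shapiro) every nontrivial convolution operator on $\mathcal H(E)$ is mixing and hypercyclic. (c) For every $k\in(1,\infty]$ and every continuous linear functional $T$ on $Exp^k_0(E)$ which is not a scalar multiple of $\delta_0\colon f\mapsto f(0)$, the functions $y\mapsto f(y+x)$ belong to $Exp^k_0(E)$ for all $f\in Exp^k_0(E)$ and $x\in E$, and the formula $(\Gamma(T)f)(x)=T\big(y\mapsto f(y+x)\big)$ defines a nontrivial convolution operator $\Gamma(T)$ on $Exp^k_0(E)$, which is mixing. -/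

import Mathlib

open scoped ENNReal NNReal Topology

set_option linter.unusedSectionVars false

noncomputable section

namespace ConvMixing

section Basic

variable {E : Type*} [NormedAddCommGroup E] [NormedSpace ℂ E]

/-- The `j`-homogeneous Taylor polynomial `x ↦ (1/j!) d̂ʲf(0)(x)` of `f` at the origin. -/
def taylorPoly (f : E → ℂ) (j : ℕ) (x : E) : ℂ :=
  ((j.factorial : ℂ))⁻¹ * iteratedFDeriv ℂ j f 0 (fun _ => x)

/-- The usual sup norm of a function (a homogeneous polynomial) over the closed unit ball. -/
def polyNorm (P : E → ℂ) : ℝ := ⨆ x : Metric.closedBall (0 : E) 1, ‖P x‖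

/-- The weight `(j / (k e))^(j / k)` (`= 1` for `j = 0`), read as `1` for `k = ∞`. -/
def weight (k : ℝ≥0∞) (j : ℕ) : ℝ :=
  if k = ∞ then 1 else ((j : ℝ) / (k.toReal * Real.exp 1)) ^ ((j : ℝ) / k.toReal)

/-- The `j`-th term `ρ⁻ʲ (j / (k e))^(j / k) ‖(1/j!) d̂ʲf(0)‖`. -/
def expTerm (k : ℝ≥0∞) (ρ : ℝ) (f : E → ℂ) (j : ℕ) : ℝ :=
  (ρ ^ j)⁻¹ * weight k j * polyNorm (taylorPoly f j)

/-- `‖f‖_{k,ρ} = ∑ⱼ ρ⁻ʲ (j / (k e))^(j / k) ‖(1/j!) d̂ʲf(0)‖`. -/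
def expNorm (k : ℝ≥0∞) (ρ : ℝ) (f : E → ℂ) : ℝ := ∑' j, expTerm k ρ f j

variable (E) in
/-- The domain of the elements of `Exp^k_{0,A}(E)`: all of `E` for finite `k`, and the open ball
of radius `1/A` (all of `E` if `A = 0`) for `k = ∞`. -/
def expDomain (k : ℝ≥0∞) (A : ℝ≥0) : Set E :=
  if k = ∞ then {x | (A : ℝ) * ‖x‖ < 1} else Set.univ

theorem isOpen_expDomain (k : ℝ≥0∞) (A : ℝ≥0) : IsOpen (expDomain E k A) := by
  unfold expDomain
  split_ifs
  · exact isOpen_lt (by fun_prop) continuous_const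
  · exact isOpen_univ

theorem zero_mem_expDomain (k : ℝ≥0∞) (A : ℝ≥0) : (0 : E) ∈ expDomain E k A := by
  unfold expDomain
  split_ifs <;> simp

/-! ### Elementary facts about Taylor polynomials -/

theorem norm_taylorPoly_le (f : E → ℂ) (j : ℕ) (x : E) :
    ‖taylorPoly f j x‖ ≤
      ‖((j.factorial : ℂ))⁻¹‖ * (‖iteratedFDeriv ℂ j f 0‖ * ‖x‖ ^ j) := by
  unfold taylorPoly
  rw [norm_mul]
  gcongr
  simpa using (iteratedFDeriv ℂ j f 0).le_opNorm (fun _ => x)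

theorem bddAbove_taylorPoly (f : E → ℂ) (j : ℕ) :
    BddAbove (Set.range fun x : Metric.closedBall (0 : E) 1 => ‖taylorPoly f j x‖) := by
  refine ⟨‖((j.factorial : ℂ))⁻¹‖ * (‖iteratedFDeriv ℂ j f 0‖ * 1), ?_⟩
  rintro _ ⟨⟨x, hx⟩, rfl⟩
  refine (norm_taylorPoly_le f j x).trans ?_
  have : ‖x‖ ≤ 1 := by simpa using hx
  gcongr
  exact pow_le_one₀ (norm_nonneg _) this

theorem polyNorm_nonneg (P : E → ℂ) : 0 ≤ polyNorm P := Real.iSup_nonneg fun _ => norm_nonneg _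

theorem norm_taylorPoly_le_polyNorm (f : E → ℂ) (j : ℕ) {x : E} (hx : ‖x‖ ≤ 1) :
    ‖taylorPoly f j x‖ ≤ polyNorm (taylorPoly f j) :=
  le_ciSup (bddAbove_taylorPoly f j) ⟨x, by simpa using hx⟩

theorem polyNorm_le {P : E → ℂ} {C : ℝ} (h : ∀ x, ‖x‖ ≤ 1 → ‖P x‖ ≤ C) : polyNorm P ≤ C := by
  have : Nonempty (Metric.closedBall (0 : E) 1) := ⟨⟨0, by simp⟩⟩
  exact ciSup_le fun x => h x (mem_closedBall_zero_iff.mp x.2)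

theorem taylorPoly_smul (f : E → ℂ) (j : ℕ) (c : ℂ) (x : E) :
    taylorPoly f j (c • x) = c ^ j * taylorPoly f j x := by
  have h := (iteratedFDeriv ℂ j f 0).map_smul_univ (fun _ => c) (fun _ => x)
  simp only [Finset.prod_const, Finset.card_univ, Fintype.card_fin, smul_eq_mul] at h
  unfold taylorPoly
  rw [h]; ring

theorem norm_taylorPoly_le_polyNorm_mul (f : E → ℂ) (j : ℕ) (x : E) :
    ‖taylorPoly f j x‖ ≤ polyNorm (taylorPoly f j) * ‖x‖ ^ j := by
  by_cases hx : x = 0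
  · subst hx
    rcases Nat.eq_zero_or_pos j with rfl | hj
    · simpa using norm_taylorPoly_le_polyNorm f 0 (x := 0) (by simp)
    · have := taylorPoly_smul f j 0 (0 : E)
      rw [smul_zero, zero_pow hj.ne', zero_mul] at this
      rw [this]; simp [hj.ne']
  · have hx' : (0 : ℝ) < ‖x‖ := norm_pos_iff.mpr hx
    have h1 := taylorPoly_smul f j (‖x‖ : ℂ) (((‖x‖ : ℂ))⁻¹ • x)
    rw [smul_smul, mul_inv_cancel₀ (by exact_mod_cast hx'.ne'), one_smul] at h1
    rw [h1, norm_mul, norm_pow, mul_comm]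
    simp only [Complex.norm_real, norm_norm]
    gcongr
    apply norm_taylorPoly_le_polyNorm
    rw [norm_smul]
    simp [hx'.ne']

theorem taylorPoly_add {f g : E → ℂ} (hf : AnalyticAt ℂ f 0) (hg : AnalyticAt ℂ g 0) (j : ℕ)
    (x : E) : taylorPoly (f + g) j x = taylorPoly f j x + taylorPoly g j x := by
  unfold taylorPoly
  rw [iteratedFDeriv_add_apply hf.contDiffAt hg.contDiffAt]
  simp [mul_add]

theorem taylorPoly_const_smul {f : E → ℂ} (hf : AnalyticAt ℂ f 0) (c : ℂ) (j : ℕ)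
    (x : E) : taylorPoly (c • f) j x = c * taylorPoly f j x := by
  unfold taylorPoly
  rw [iteratedFDeriv_const_smul_apply hf.contDiffAt]
  simp only [_root_.smul_apply, smul_eq_mul]
  ring

theorem polyNorm_add_le {f g : E → ℂ} (hf : AnalyticAt ℂ f 0) (hg : AnalyticAt ℂ g 0) (j : ℕ) :
    polyNorm (taylorPoly (f + g) j) ≤ polyNorm (taylorPoly f j) + polyNorm (taylorPoly g j) := by
  refine polyNorm_le fun x hx => ?_
  rw [taylorPoly_add hf hg]
  exact (norm_add_le _ _).trans
    (add_le_add (norm_taylorPoly_le_polyNorm f j hx) (norm_taylorPoly_le_polyNorm g j hx))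

theorem polyNorm_const_smul {f : E → ℂ} (hf : AnalyticAt ℂ f 0) (c : ℂ) (j : ℕ) :
    polyNorm (taylorPoly (c • f) j) = ‖c‖ * polyNorm (taylorPoly f j) := by
  unfold polyNorm
  simp_rw [taylorPoly_const_smul hf, norm_mul]
  exact (Real.mul_iSup_of_nonneg (norm_nonneg c) _).symm

theorem weight_nonneg (k : ℝ≥0∞) (j : ℕ) : 0 ≤ weight k j := by
  unfold weight
  split_ifs <;> positivity

theorem expTerm_nonneg (k : ℝ≥0∞) {ρ : ℝ} (hρ : 0 ≤ ρ) (f : E → ℂ) (j : ℕ) :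
    0 ≤ expTerm k ρ f j :=
  mul_nonneg (mul_nonneg (by positivity) (weight_nonneg k j)) (polyNorm_nonneg _)

theorem expTerm_add_le (k : ℝ≥0∞) {ρ : ℝ} (hρ : 0 ≤ ρ) {f g : E → ℂ}
    (hf : AnalyticAt ℂ f 0) (hg : AnalyticAt ℂ g 0) (j : ℕ) :
    expTerm k ρ (f + g) j ≤ expTerm k ρ f j + expTerm k ρ g j := by
  unfold expTerm
  rw [← mul_add]
  exact mul_le_mul_of_nonneg_left (polyNorm_add_le hf hg j)
    (mul_nonneg (by positivity) (weight_nonneg k j))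

theorem expTerm_const_smul (k : ℝ≥0∞) (ρ : ℝ) {f : E → ℂ}
    (hf : AnalyticAt ℂ f 0) (c : ℂ) (j : ℕ) :
    expTerm k ρ (c • f) j = ‖c‖ * expTerm k ρ f j := by
  unfold expTerm
  rw [polyNorm_const_smul hf]; ring

theorem taylorPoly_zero_fun (j : ℕ) (x : E) : taylorPoly (0 : E → ℂ) j x = 0 := by
  have := taylorPoly_const_smul (f := (0 : E → ℂ)) analyticAt_const 0 j x
  simpa using this

theorem expTerm_zero_fun (k : ℝ≥0∞) (ρ : ℝ) (j : ℕ) : expTerm k ρ (0 : E → ℂ) j = 0 := by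
  have := expTerm_const_smul k ρ (f := (0 : E → ℂ)) analyticAt_const 0 j
  simpa using this

end Basic

section Space

variable (k : ℝ≥0∞) (A : ℝ≥0) (E : Type*) [NormedAddCommGroup E] [NormedSpace ℂ E]

/-- The vector space underlying `Exp^k_{0,A}(E)`. Its elements are the holomorphic functions on
`expDomain E k A` with `‖f‖_{k,ρ} < ∞` for all `ρ > A`, represented as functions on `E` which
vanish off that domain. -/
def expSubmodule : Submodule ℂ (E → ℂ) where
  carrier := {f | (∀ x ∉ expDomain E k A, f x = 0) ∧ AnalyticOnNhd ℂ f (expDomain E k A) ∧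
    ∀ ρ : ℝ, (A : ℝ) < ρ → Summable (expTerm k ρ f)}
  zero_mem' := by
    refine ⟨fun _ _ => rfl, analyticOnNhd_const, fun ρ _ => ?_⟩
    exact summable_zero.congr fun j => (expTerm_zero_fun k ρ j).symm
  add_mem' := by
    rintro f g ⟨hf0, hf, hfs⟩ ⟨hg0, hg, hgs⟩
    refine ⟨fun x hx => by simp [hf0 x hx, hg0 x hx], hf.add hg, fun ρ hρ => ?_⟩
    have hρ0 : 0 ≤ ρ := A.coe_nonneg.trans hρ.le
    exact Summable.of_nonneg_of_le (expTerm_nonneg k hρ0 _)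
      (expTerm_add_le k hρ0 (hf 0 (zero_mem_expDomain k A)) (hg 0 (zero_mem_expDomain k A)))
      ((hfs ρ hρ).add (hgs ρ hρ))
  smul_mem' := by
    rintro c f ⟨hf0, hf, hfs⟩
    refine ⟨fun x hx => by simp [hf0 x hx], fun x hx => (hf x hx).const_smul, fun ρ hρ => ?_⟩
    exact ((hfs ρ hρ).mul_left ‖c‖).congr
      fun j => (expTerm_const_smul k ρ (hf 0 (zero_mem_expDomain k A)) c j).symm

/-- The space `Exp^k_{0,A}(E)`. (It is a type of its own, so as not to inherit the topology of
pointwise convergence.) -/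
def ExpSpace : Type _ := ↥(expSubmodule k A E)

instance : AddCommGroup (ExpSpace k A E) := inferInstanceAs (AddCommGroup ↥(expSubmodule k A E))
instance : Module ℂ (ExpSpace k A E) := inferInstanceAs (Module ℂ ↥(expSubmodule k A E))
instance : CoeFun (ExpSpace k A E) (fun _ => E → ℂ) := ⟨fun f => f.1⟩

variable {k A E}

theorem ExpSpace.analyticAt_zero (f : ExpSpace k A E) : AnalyticAt ℂ (f : E → ℂ) 0 :=
  f.2.2.1 0 (zero_mem_expDomain k A)

variable (k A E) in
/-- The seminorms `‖·‖_{k,ρ}`, `ρ > A`, on `Exp^k_{0,A}(E)`. -/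
def expSeminorm (ρ : {ρ : ℝ // (A : ℝ) < ρ}) : Seminorm ℂ (ExpSpace k A E) :=
  Seminorm.of (fun f => expNorm k ρ.1 (f : E → ℂ))
    (fun f g => by
      have hρ0 : 0 ≤ ρ.1 := A.coe_nonneg.trans ρ.2.le
      have hf := f.2.2.2 ρ.1 ρ.2
      have hg := g.2.2.2 ρ.1 ρ.2
      have hfg := (f + g).2.2.2 ρ.1 ρ.2
      unfold expNorm
      rw [← hf.tsum_add hg]
      exact hfg.tsum_le_tsum
        (expTerm_add_le k hρ0 f.analyticAt_zero g.analyticAt_zero) (hf.add hg))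
    (fun c f => by
      have h : ∀ j, expTerm k ρ.1 ((c • f : ExpSpace k A E) : E → ℂ) j
          = ‖c‖ * expTerm k ρ.1 (f : E → ℂ) j :=
        expTerm_const_smul k ρ.1 f.analyticAt_zero c
      unfold expNorm
      rw [tsum_congr h, tsum_mul_left])

instance : Nonempty {ρ : ℝ // (A : ℝ) < ρ} := ⟨⟨A + 1, by simp⟩⟩

/-- The locally convex topology generated by the seminorms `‖·‖_{k,ρ}`, `ρ > A`. -/
instance : TopologicalSpace (ExpSpace k A E) :=
  SeminormFamily.moduleFilterBasis (𝕜 := ℂ) (expSeminorm k A E) |>.topology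

theorem withSeminorms_expSeminorm : WithSeminorms (expSeminorm k A E) := ⟨rfl⟩

end Space

/-! ### Directional derivatives act on the spaces -/

section DirDeriv

variable {E : Type*} [NormedAddCommGroup E] [NormedSpace ℂ E]

/-- The directional derivative `x ↦ df(x)(a)`, taken on `U` and extended by zero. -/
def dirDerivOn (U : Set E) (f : E → ℂ) (a : E) : E → ℂ :=
  U.indicator fun x => fderiv ℂ f x a

theorem taylorPoly_dirDerivOn {U : Set E} (hU : U ∈ 𝓝 (0 : E)) {f : E → ℂ}
    (hf : AnalyticAt ℂ f 0) (a : E) (j : ℕ) (x : E) :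
    taylorPoly (dirDerivOn U f a) j x
      = deriv (fun t : ℂ => taylorPoly f (j + 1) (x + t • a)) 0 := by
  have h1 : dirDerivOn U f a =ᶠ[𝓝 0] fun y => fderiv ℂ f y a := by
    filter_upwards [hU] with y hy
    simp [dirDerivOn, hy]
  have h2 : iteratedFDeriv ℂ j (dirDerivOn U f a) 0 (fun _ => x)
      = iteratedFDeriv ℂ (j + 1) f 0 (Fin.snoc (fun _ : Fin j => x) a) := by
    rw [(h1.iteratedFDeriv ℂ j).eq_of_nhds, iteratedFDeriv_succ_apply_right]
    have h3 : (fun y => fderiv ℂ f y a)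
        = (ContinuousLinearMap.apply ℂ ℂ a) ∘ (fun y => fderiv ℂ f y) := by
      ext y; simp
    rw [h3, ContinuousLinearMap.iteratedFDeriv_comp_left (n := j) _
      (hf.fderiv.contDiffAt) le_rfl]
    simp
  have h4 : ∀ i : Fin (j + 1), iteratedFDeriv ℂ (j + 1) f 0
      (Function.update (fun _ => x) i a)
      = iteratedFDeriv ℂ (j + 1) f 0 (Fin.snoc (fun _ : Fin j => x) a) := by
    intro i
    have hs := hf.contDiffAt (n := ⊤)
    have := ContDiffAt.iteratedFDeriv_comp_perm hs
      (v := Function.update (fun _ => x) i a) (Equiv.swap i (Fin.last j))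
    rw [← this]
    congr 1
    ext l
    simp only [Function.comp_apply, Function.update_apply]
    refine Fin.lastCases ?_ (fun m => ?_) l
    · simp
    · have hne : Equiv.swap i (Fin.last j) m.castSucc ≠ i := by
        intro h
        rw [Equiv.swap_apply_eq_iff, Equiv.swap_apply_left] at h
        exact (Fin.castSucc_lt_last m).ne h
      simp [hne]
  have h5 : HasDerivAt (fun t : ℂ => taylorPoly f (j + 1) (x + t • a))
      ((((j + 1).factorial : ℂ))⁻¹ *
        ∑ i : Fin (j + 1), iteratedFDeriv ℂ (j + 1) f 0 (Function.update (fun _ => x) i a)) 0 := by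
    have hM := (iteratedFDeriv ℂ (j + 1) f 0).hasFDerivAt (fun _ => x)
    have hline : HasDerivAt (fun t : ℂ => (fun _ : Fin (j + 1) => x + t • a))
        (fun _ : Fin (j + 1) => a) 0 := by
      refine hasDerivAt_pi.mpr fun _ => ?_
      simpa using ((hasDerivAt_id (0 : ℂ)).smul_const a).const_add x
    have h0 : (fun _ : Fin (j + 1) => x) = (fun _ : Fin (j + 1) => x + (0 : ℂ) • a) := by simp
    have hM' : HasFDerivAt (iteratedFDeriv ℂ (j + 1) f 0)
        ((iteratedFDeriv ℂ (j + 1) f 0).linearDeriv (fun _ => x))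
        (fun _ : Fin (j + 1) => x + (0 : ℂ) • a) := h0 ▸ hM
    have := (hM'.comp_hasDerivAt (0 : ℂ) hline).const_mul ((((j + 1).factorial : ℂ))⁻¹)
    simpa [ContinuousMultilinearMap.linearDeriv_apply, taylorPoly, Function.comp_def] using this
  rw [h5.deriv]
  simp_rw [h4]
  rw [taylorPoly, h2]
  simp only [Finset.sum_const, Finset.card_univ, Fintype.card_fin, nsmul_eq_mul]
  rw [Nat.factorial_succ]
  push_cast
  have : (j : ℂ) + 1 ≠ 0 := by exact_mod_cast Nat.succ_ne_zero j
  have : ((j.factorial : ℂ)) ≠ 0 := by exact_mod_cast j.factorial_ne_zero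
  field_simp

theorem polyNorm_dirDerivOn_le {U : Set E} (hU : U ∈ 𝓝 (0 : E)) {f : E → ℂ}
    (hf : AnalyticAt ℂ f 0) (a : E) (j : ℕ) :
    polyNorm (taylorPoly (dirDerivOn U f a) j)
      ≤ (1 + ‖a‖) * Real.exp 1 * (j + 1) * polyNorm (taylorPoly f (j + 1)) := by
  refine polyNorm_le fun x hx => ?_
  rw [taylorPoly_dirDerivOn hU hf]
  set p := polyNorm (taylorPoly f (j + 1)) with hp
  have hp0 : 0 ≤ p := polyNorm_nonneg _
  have hj : (0 : ℝ) < j + 1 := by positivity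
  have ha : (0 : ℝ) < 1 + ‖a‖ := by positivity
  set R : ℝ := 1 / ((j + 1) * (1 + ‖a‖)) with hR
  have hR0 : 0 < R := by positivity
  have hd : Differentiable ℂ (fun t : ℂ => taylorPoly f (j + 1) (x + t • a)) := by
    unfold taylorPoly
    have : Differentiable ℂ (fun t : ℂ => (fun _ : Fin (j + 1) => x + t • a)) := by fun_prop
    have h2 : Differentiable ℂ (iteratedFDeriv ℂ (j + 1) f 0) :=
      fun m => ((iteratedFDeriv ℂ (j + 1) f 0).hasFDerivAt m).differentiableAt
    exact (h2.comp this).const_mul _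
  have hC : ∀ z ∈ Metric.sphere (0 : ℂ) R, ‖taylorPoly f (j + 1) (x + z • a)‖
      ≤ p * Real.exp 1 := by
    intro z hz
    have hz' : ‖z‖ = R := by simpa using hz
    refine (norm_taylorPoly_le_polyNorm_mul f (j + 1) _).trans ?_
    refine mul_le_mul_of_nonneg_left ?_ hp0
    have hn : ‖x + z • a‖ ≤ Real.exp (1 / (j + 1)) := by
      have h1 : R * ‖a‖ ≤ 1 / (j + 1) := by
        rw [hR, div_mul_eq_mul_div, one_mul, div_le_div_iff₀ (by positivity) hj]
        nlinarith [norm_nonneg a]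
      calc ‖x + z • a‖ ≤ ‖x‖ + ‖z • a‖ := norm_add_le _ _
        _ ≤ 1 + R * ‖a‖ := by rw [norm_smul, hz']; gcongr
        _ ≤ 1 / (j + 1) + 1 := by linarith
        _ ≤ _ := Real.add_one_le_exp _
    calc ‖x + z • a‖ ^ (j + 1) ≤ Real.exp (1 / (j + 1)) ^ (j + 1) := by gcongr
      _ = Real.exp 1 := by
        rw [← Real.exp_nat_mul]
        push_cast
        rw [mul_one_div_cancel hj.ne']
  refine (Complex.norm_deriv_le_of_forall_mem_sphere_norm_le hR0
    hd.diffContOnCl hC).trans (le_of_eq ?_)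
  rw [hR]
  field_simp

theorem exists_weight_le (k : ℝ≥0∞) : ∃ C : ℝ, 0 ≤ C ∧ ∀ j, weight k j ≤ C * weight k (j + 1) := by
  by_cases hk : k = ∞
  · exact ⟨1, zero_le_one, fun j => by simp [weight, hk]⟩
  by_cases hk0 : k = 0
  · exact ⟨1, zero_le_one, fun j => by simp [weight, hk0]⟩
  have hr : 0 < k.toReal := ENNReal.toReal_pos hk0 hk
  set r := k.toReal
  set D := r * Real.exp 1 with hD
  have hD0 : 0 < D := by positivity
  refine ⟨D ^ (1 / r), by positivity, fun j => ?_⟩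
  simp only [weight, hk, if_false]
  push_cast
  have h1 : ((j : ℝ) + 1) / r = (j : ℝ) / r + 1 / r := by ring
  have hb : 0 < ((j : ℝ) + 1) / D := by positivity
  rw [h1, Real.rpow_add hb]
  have h2 : (1 : ℝ) ≤ D ^ (1 / r) * (((j : ℝ) + 1) / D) ^ (1 / r) := by
    rw [← Real.mul_rpow hD0.le hb.le, mul_div_cancel₀ _ hD0.ne']
    exact Real.one_le_rpow (by simp) (by positivity)
  have h3 : ((j : ℝ) / D) ^ ((j : ℝ) / r) ≤ (((j : ℝ) + 1) / D) ^ ((j : ℝ) / r) := by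
    apply Real.rpow_le_rpow (by positivity) _ (by positivity)
    gcongr
    linarith
  have h4 : 0 ≤ (((j : ℝ) + 1) / D) ^ ((j : ℝ) / r) := by positivity
  nlinarith [mul_le_mul_of_nonneg_left h2 h4]

theorem summable_expTerm_dirDerivOn {k : ℝ≥0∞} {A : ℝ≥0} {U : Set E} (hU : U ∈ 𝓝 (0 : E))
    {f : E → ℂ} (hf : AnalyticAt ℂ f 0)
    (hs : ∀ ρ : ℝ, (A : ℝ) < ρ → Summable (expTerm k ρ f)) (a : E) (ρ : ℝ) (hρ : (A : ℝ) < ρ) :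
    Summable (expTerm k ρ (dirDerivOn U f a)) := by
  have hA : (0 : ℝ) ≤ A := A.coe_nonneg
  obtain ⟨s, hAs, hsρ⟩ := exists_between hρ
  have hs0 : 0 < s := hA.trans_lt hAs
  have hρ0 : 0 < ρ := hs0.trans hsρ
  obtain ⟨C, hC0, hC⟩ := exists_weight_le k
  set q := s / ρ with hq
  have hq0 : 0 ≤ q := by positivity
  have hq1 : q < 1 := (div_lt_one hρ0).mpr hsρ
  obtain ⟨B, hB⟩ := (tendsto_self_mul_const_pow_of_lt_one hq0 hq1).bddAbove_range
  have hB' : ∀ j : ℕ, ((j : ℝ) + 1) * q ^ j ≤ B + 1 := fun j => by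
    have h1 : (j : ℝ) * q ^ j ≤ B := hB ⟨j, rfl⟩
    have h2 : q ^ j ≤ 1 := pow_le_one₀ hq0 hq1.le
    linarith
  set K := (1 + ‖a‖) * Real.exp 1 with hK
  have hK0 : 0 ≤ K := by positivity
  refine Summable.of_nonneg_of_le (expTerm_nonneg k hρ0.le _) (fun j => ?_)
    (((summable_nat_add_iff 1).mpr (hs s hAs)).mul_left (K * C * s * (B + 1)))
  unfold expTerm
  set p := polyNorm (taylorPoly f (j + 1))
  have hp0 : 0 ≤ p := polyNorm_nonneg _
  have hw := weight_nonneg k (j + 1)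
  calc (ρ ^ j)⁻¹ * weight k j * polyNorm (taylorPoly (dirDerivOn U f a) j)
      ≤ (ρ ^ j)⁻¹ * (C * weight k (j + 1)) * (K * (j + 1) * p) := by
        gcongr
        · exact polyNorm_nonneg _
        · exact hC j
        · exact polyNorm_dirDerivOn_le hU hf a j
    _ = K * C * s * (((j : ℝ) + 1) * q ^ j) * ((s ^ (j + 1))⁻¹ * weight k (j + 1) * p) := by
        rw [hq, div_pow, pow_succ]
        field_simp
    _ ≤ K * C * s * (B + 1) * ((s ^ (j + 1))⁻¹ * weight k (j + 1) * p) := by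
        gcongr
        exact hB' j

/-- The directional derivative `df(·)(a)` as an element of `Exp^k_{0,A}(E)`. -/
def ExpSpace.dirDeriv {k : ℝ≥0∞} {A : ℝ≥0} (a : E) (f : ExpSpace k A E) : ExpSpace k A E :=
  ⟨dirDerivOn (expDomain E k A) f a, by
    refine ⟨fun x hx => Set.indicator_of_notMem hx _, fun x hx => ?_, fun ρ hρ => ?_⟩
    · have h : AnalyticAt ℂ (fun y => fderiv ℂ (f : E → ℂ) y a) x :=
        ((ContinuousLinearMap.apply ℂ ℂ a).analyticAt _).comp (f.2.2.1 x hx).fderiv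
      refine h.congr ?_
      filter_upwards [(isOpen_expDomain k A).mem_nhds hx] with y hy
      simp [dirDerivOn, hy]
    · exact summable_expTerm_dirDerivOn
        ((isOpen_expDomain k A).mem_nhds (zero_mem_expDomain k A)) f.analyticAt_zero
        f.2.2.2 a ρ hρ⟩

end DirDeriv

/-! ### The space of entire functions with the compact-open topology -/

section Entire

variable (E : Type*) [NormedAddCommGroup E] [NormedSpace ℂ E]

/-- The space `H(E)` of entire functions on `E`, a subspace of `C(E, ℂ)` and hence carrying the
topology of uniform convergence on compact sets. -/
def EntireSpace : Submodule ℂ C(E, ℂ) where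
  carrier := {f | AnalyticOnNhd ℂ (f : E → ℂ) Set.univ}
  zero_mem' := analyticOnNhd_const
  add_mem' hf hg := hf.add hg
  smul_mem' _ _ hf := fun x hx => (hf x hx).const_smul

variable {E}

/-- The directional derivative `df(·)(a)` as an element of `H(E)`. -/
def EntireSpace.dirDeriv (a : E) (f : EntireSpace E) : EntireSpace E :=
  have h : AnalyticOnNhd ℂ (fun x => fderiv ℂ (f : C(E, ℂ)) x a) Set.univ :=
    fun x hx => ((ContinuousLinearMap.apply ℂ ℂ a).analyticAt _).comp (f.2 x hx).fderiv
  ⟨⟨fun x => fderiv ℂ (f : C(E, ℂ)) x a, continuousOn_univ.mp h.continuousOn⟩, h⟩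

end Entire

/-! ### Linear dynamics -/

section Dynamics

variable {X : Type*} [TopologicalSpace X] [AddCommMonoid X] [Module ℂ X]

/-- `T` is mixing: for all nonempty open `U`, `V` one has `Tⁿ(U) ∩ V ≠ ∅` for all large `n`. -/
def IsMixing (T : X →L[ℂ] X) : Prop :=
  ∀ U V : Set X, IsOpen U → IsOpen V → U.Nonempty → V.Nonempty →
    ∃ n₀ : ℕ, ∀ n ≥ n₀, (((⇑T)^[n] '' U) ∩ V).Nonempty

/-- `T` is hypercyclic: some orbit `{x, T x, T² x, …}` is dense. -/
def IsHypercyclic (T : X →L[ℂ] X) : Prop :=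
  ∃ x : X, Dense (Set.range fun n : ℕ => (⇑T)^[n] x)

/-- `T` is not a scalar multiple of the identity. -/
def IsNontrivial (T : X →L[ℂ] X) : Prop := ¬ ∃ c : ℂ, ∀ x, T x = c • x

end Dynamics

section Convolution

variable {E : Type*} [NormedAddCommGroup E] [NormedSpace ℂ E]

/-- A convolution operator on `Exp^k_{0,A}(E)`: a continuous linear self-map which commutes with
all directional derivatives. -/
def IsConvolutionOperator {k : ℝ≥0∞} {A : ℝ≥0} (L : ExpSpace k A E →L[ℂ] ExpSpace k A E) : Prop :=
  ∀ (a : E) (f : ExpSpace k A E), (L f).dirDeriv a = L (f.dirDeriv a)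

/-- A convolution operator on `H(E)`: a continuous linear self-map which commutes with all
directional derivatives. -/
def IsConvolutionOperatorEntire (L : EntireSpace E →L[ℂ] EntireSpace E) : Prop :=
  ∀ (a : E) (f : EntireSpace E),
    EntireSpace.dirDeriv a (L f) = L (EntireSpace.dirDeriv a f)

end Convolution

end ConvMixing

end

namespace ConvMixing

/-! ### Taylor polynomials versus full derivatives -/

section Taylor

variable {E : Type*} [NormedAddCommGroup E] [NormedSpace ℂ E]

/-! The engine is the Godefroy–Shapiro criterion: if the eigenvectors of an operator with
eigenvalues of modulus less than one span a dense subspace, and so do those with modulus greater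
than one, the operator is mixing (`isMixing_of_eigenvectors`). For a convolution operator `L` the
eigenvectors are the exponentials of linear forms. They lie in the space because `k > 1`, and they
are, up to scalars, the only joint eigenvectors of the directional derivatives
(`eq_smul_expVec_of_dirDeriv`), so `L`, commuting with these derivatives, maps each of them to a
multiple of itself. The eigenvalue is an entire function of the linear form; it is nonconstant when
`L` is nontrivial, and Liouville's theorem gives both moduli on nonempty open sets. The exponentials
of any nonempty open set of forms span a dense subspace by Hahn–Banach (`dense_span_expVec`): the
transform of an annihilating functional is entire, vanishes on an open set, hence everywhere, and
its Taylor coefficients determine the functional on homogeneous polynomials, which is enough because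
Taylor series converge in the space.

For `H(E)`, Cauchy estimates identify the topology with that of `Exp^∞_0(E)`, so mixing is
transported. Hypercyclicity then follows from Birkhoff's transitivity theorem, as `H(E)` is closed
in `C(E, ℂ)`, hence complete, and second countable.

For functionals, the translate of `f` by `x` is the sum of `D_x^i f / i!`, converging in
`Exp^k_0(E)`. One estimate of the norms of iterated derivatives (`ExpSpace.expNorm_iterDirDeriv_le`)
yields that convergence, and the analyticity and continuity of the convolution operator. -/

theorem taylorPoly_of_hasFPowerSeriesAt {f : E → ℂ} {p : FormalMultilinearSeries ℂ E ℂ}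
    (hf : HasFPowerSeriesAt f p 0) (j : ℕ) (x : E) : taylorPoly f j x = p j fun _ => x := by
  obtain ⟨r, hr⟩ := hf
  have h := hr.factorial_smul x j
  rw [taylorPoly, ← h, nsmul_eq_mul, inv_mul_cancel_left₀]
  exact_mod_cast j.factorial_ne_zero

theorem taylorPoly_congr {f g : E → ℂ} (h : f =ᶠ[𝓝 0] g) (j : ℕ) (x : E) :
    taylorPoly f j x = taylorPoly g j x := by
  unfold taylorPoly
  rw [(h.iteratedFDeriv ℂ j).eq_of_nhds]

theorem polyNorm_le_norm_iteratedFDeriv (f : E → ℂ) (j : ℕ) :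
    polyNorm (taylorPoly f j) ≤ (j.factorial : ℝ)⁻¹ * ‖iteratedFDeriv ℂ j f 0‖ := by
  refine polyNorm_le fun x hx => (norm_taylorPoly_le f j x).trans ?_
  rw [norm_inv, Complex.norm_natCast]
  gcongr
  exact mul_le_of_le_one_right (norm_nonneg _) (pow_le_one₀ (norm_nonneg _) hx)

theorem iteratedFDeriv_dirDerivOn_univ {f : E → ℂ} (hf : AnalyticAt ℂ f 0) (a : E) (j : ℕ)
    (v : Fin j → E) :
    iteratedFDeriv ℂ j (dirDerivOn Set.univ f a) 0 v
      = iteratedFDeriv ℂ (j + 1) f 0 (Fin.snoc v a) := by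
  have h3 : dirDerivOn Set.univ f a
      = (ContinuousLinearMap.apply ℂ ℂ a) ∘ (fun y => fderiv ℂ f y) := by
    ext y; simp [dirDerivOn]
  rw [iteratedFDeriv_succ_apply_right, h3, ContinuousLinearMap.iteratedFDeriv_comp_left (n := j) _
      (hf.fderiv.contDiffAt) le_rfl]
  simp

theorem analyticAt_dirDerivOn_univ {f : E → ℂ} {x : E} (hf : AnalyticAt ℂ f x) (a : E) :
    AnalyticAt ℂ (dirDerivOn Set.univ f a) x := by
  have h3 : dirDerivOn Set.univ f a
      = (ContinuousLinearMap.apply ℂ ℂ a) ∘ (fun y => fderiv ℂ f y) := by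
    ext y; simp [dirDerivOn]
  rw [h3]
  exact ((ContinuousLinearMap.apply ℂ ℂ a).analyticAt _).comp hf.fderiv

/-- A crude substitute for the polarization formula. Peeling off the last argument is a directional
derivative, whose Taylor polynomials are controlled by Cauchy's estimate; the factors `j + 1` so
produced multiply to the factorial. -/
theorem norm_iteratedFDeriv_apply_le_prod (j : ℕ) : ∀ {f : E → ℂ}, AnalyticAt ℂ f 0 →
    ∀ v : Fin j → E, ‖iteratedFDeriv ℂ j f 0 v‖
      ≤ j.factorial * (∏ i, ((1 + ‖v i‖) * Real.exp 1)) * polyNorm (taylorPoly f j) := by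
  induction j with
  | zero =>
    intro f hf v
    have := norm_taylorPoly_le_polyNorm f 0 (x := (0 : E)) (by simp)
    simpa [taylorPoly] using this
  | succ j ih =>
    intro f hf v
    have h := ih (analyticAt_dirDerivOn_univ hf (v (Fin.last j))) (Fin.init v)
    rw [iteratedFDeriv_dirDerivOn_univ hf, Fin.snoc_init_self] at h
    refine h.trans ?_
    rw [Fin.prod_univ_castSucc, Nat.factorial_succ]
    push_cast
    calc _ ≤ (j.factorial : ℝ) * (∏ i, ((1 + ‖Fin.init v i‖) * Real.exp 1)) *
          ((1 + ‖v (Fin.last j)‖) * Real.exp 1 * (j + 1) * polyNorm (taylorPoly f (j + 1))) := by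
            gcongr
            exact polyNorm_dirDerivOn_le Filter.univ_mem hf _ j
      _ = _ := by simp only [Fin.init]; ring

theorem norm_le_of_unit_bound {j : ℕ} (q : ContinuousMultilinearMap ℂ (fun _ : Fin j => E) ℂ)
    {C : ℝ} (hC : 0 ≤ C) (h : ∀ v : Fin j → E, (∀ i, ‖v i‖ ≤ 1) → ‖q v‖ ≤ C) : ‖q‖ ≤ C := by
  refine q.opNorm_le_bound hC fun v => ?_
  by_cases hv : ∃ i, v i = 0
  · obtain ⟨i, hi⟩ := hv
    rw [q.map_coord_zero i hi, norm_zero]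
    positivity
  push Not at hv
  have hv' : ∀ i, (‖v i‖ : ℂ) ≠ 0 := fun i => by
    simpa using hv i
  have h1 : v = fun i => (‖v i‖ : ℂ) • ((‖v i‖ : ℂ)⁻¹ • v i) := by
    ext i
    rw [smul_smul, mul_inv_cancel₀ (hv' i), one_smul]
  have h2 := q.map_smul_univ (fun i => (‖v i‖ : ℂ)) (fun i => (‖v i‖ : ℂ)⁻¹ • v i)
  rw [← h1] at h2
  rw [h2, norm_smul, norm_prod, mul_comm]
  simp only [Complex.norm_real, norm_norm]
  gcongr
  refine h _ fun i => ?_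
  rw [norm_smul, norm_inv, Complex.norm_real, norm_norm, inv_mul_cancel₀ (by simpa using hv i)]

/-- The product bound above is not homogeneous in the `v i`, so it is used on unit vectors only,
where each factor is at most `2e`. Any loss that is exponential in `j` is harmless later, since it
can be absorbed by changing `ρ`. -/
theorem norm_iteratedFDeriv_le_polyNorm {f : E → ℂ} (hf : AnalyticAt ℂ f 0) (j : ℕ) :
    ‖iteratedFDeriv ℂ j f 0‖
      ≤ j.factorial * (2 * Real.exp 1) ^ j * polyNorm (taylorPoly f j) := by
  have hp := polyNorm_nonneg (taylorPoly f j)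
  refine norm_le_of_unit_bound _ (by positivity) fun v hv => ?_
  refine (norm_iteratedFDeriv_apply_le_prod j hf v).trans ?_
  gcongr
  calc ∏ i, ((1 + ‖v i‖) * Real.exp 1) ≤ ∏ _i : Fin j, (2 * Real.exp 1) := by
        gcongr with i
        linarith [hv i]
    _ = _ := by simp

theorem weight_pos (k : ℝ≥0∞) (j : ℕ) : 0 < weight k j := by
  unfold weight
  split_ifs with hk
  · exact one_pos
  rcases (ENNReal.toReal_nonneg (a := k)).eq_or_lt with h | h
  · simp [← h]
  rcases Nat.eq_zero_or_pos j with rfl | hj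
  · simp
  · have : (0 : ℝ) < j := by exact_mod_cast hj
    positivity

end Taylor

/-! ### The topology of the space and summation criteria -/

section Space

variable {k : ℝ≥0∞} {A : ℝ≥0} {E : Type*} [NormedAddCommGroup E] [NormedSpace ℂ E]

instance : IsTopologicalAddGroup (ExpSpace k A E) := withSeminorms_expSeminorm.topologicalAddGroup

instance : ContinuousSMul ℂ (ExpSpace k A E) := withSeminorms_expSeminorm.continuousSMul

instance : LocallyConvexSpace ℝ (ExpSpace k A E) := by
  have : PolynormableSpace ℂ (ExpSpace k A E) := withSeminorms_expSeminorm.toPolynormableSpace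
  exact withSeminorms_expSeminorm.toLocallyConvexSpace

theorem ExpSpace.summable (f : ExpSpace k A E) {ρ : ℝ} (hρ : (A : ℝ) < ρ) :
    Summable (expTerm k ρ (f : E → ℂ)) := f.2.2.2 ρ hρ

theorem ExpSpace.ext {f g : ExpSpace k A E} (h : ∀ x, (f : E → ℂ) x = g x) : f = g :=
  Subtype.ext (funext h)

theorem expNorm_nonneg {ρ : ℝ} (hρ : (A : ℝ) < ρ) (f : E → ℂ) : 0 ≤ expNorm k ρ f :=
  tsum_nonneg (expTerm_nonneg k (A.coe_nonneg.trans hρ.le) f)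

theorem expTerm_anti {ρ σ : ℝ} (hρ : 0 < ρ) (h : ρ ≤ σ) (f : E → ℂ) (j : ℕ) :
    expTerm k σ f j ≤ expTerm k ρ f j := by
  unfold expTerm
  have := weight_nonneg k j
  have := polyNorm_nonneg (taylorPoly f j)
  gcongr

theorem expSeminorm_anti {ρ σ : {ρ : ℝ // (A : ℝ) < ρ}} (h : ρ ≤ σ) :
    expSeminorm k A E σ ≤ expSeminorm k A E ρ := fun f =>
  (f.summable σ.2).tsum_le_tsum (expTerm_anti (A.coe_nonneg.trans_lt ρ.2) h f) (f.summable ρ.2)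

/-- A continuous seminorm is dominated by a multiple of one of the norms `‖·‖_{k,ρ}`. -/
theorem Seminorm.exists_le_expNorm {p : Seminorm ℂ (ExpSpace k A E)} (hp : Continuous p) :
    ∃ ρ : ℝ, (A : ℝ) < ρ ∧ ∃ C : ℝ, 0 ≤ C ∧ ∀ f, p f ≤ C * expNorm k ρ (f : E → ℂ) := by
  obtain ⟨s, C, -, hC⟩ := Seminorm.bound_of_continuous withSeminorms_expSeminorm p hp
  -- The lower bound is taken in the subtype, so it still exceeds `A`; the norms decrease in `ρ`, so
  -- this one dominates the finite supremum.
  obtain ⟨m, hm⟩ := s.bddBelow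
  refine ⟨m.1, m.2, C, C.2, fun f => (hC f).trans ?_⟩
  have h : s.sup (expSeminorm k A E) ≤ expSeminorm k A E m :=
    Finset.sup_le fun i hi => expSeminorm_anti (hm hi)
  exact mul_le_mul_of_nonneg_left (h f) C.2

theorem ExpSpace.exists_norm_le (T : ExpSpace k A E →L[ℂ] ℂ) :
    ∃ ρ : ℝ, (A : ℝ) < ρ ∧ ∃ C : ℝ, 0 ≤ C ∧ ∀ f, ‖T f‖ ≤ C * expNorm k ρ (f : E → ℂ) :=
  Seminorm.exists_le_expNorm (p := (normSeminorm ℂ ℂ).comp (T : ExpSpace k A E →ₗ[ℂ] ℂ))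
    T.continuous.norm

/-- A linear functional dominated by one of the norms is continuous. -/
theorem ExpSpace.continuous_of_norm_le (T : ExpSpace k A E →ₗ[ℂ] ℂ) {ρ : ℝ} (hρ : (A : ℝ) < ρ)
    {C : ℝ} (hT : ∀ f, ‖T f‖ ≤ C * expNorm k ρ (f : E → ℂ)) : Continuous T := by
  refine continuous_of_continuousAt_zero T ?_
  rw [ContinuousAt, map_zero]
  refine squeeze_zero_norm hT ?_
  have h : Continuous fun f => C * expSeminorm k A E ⟨ρ, hρ⟩ f :=
    continuous_const.mul (withSeminorms_expSeminorm.continuous_seminorm _)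
  have := h.tendsto 0
  rwa [map_zero, mul_zero] at this

variable (k A) in
/-- Evaluation of the `j`-th Taylor polynomial, as a linear functional. -/
noncomputable def taylorLin (j : ℕ) (x : E) : ExpSpace k A E →ₗ[ℂ] ℂ where
  toFun f := taylorPoly (f : E → ℂ) j x
  map_add' f g := taylorPoly_add f.analyticAt_zero g.analyticAt_zero j x
  map_smul' c f := taylorPoly_const_smul f.analyticAt_zero c j x

/-- If the Taylor polynomials of `g` are the sums of those of a family `h` which is summable in
norm, then the norms of `g` are dominated by the sums of the norms of `h`. -/
theorem summable_expTerm_of_hasSum {ι : Type*} {h : ι → ExpSpace k A E} {g : E → ℂ} {ρ : ℝ}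
    (hρ : (A : ℝ) < ρ) (hs : Summable fun i => expNorm k ρ (h i : E → ℂ))
    (hg : ∀ j, ∀ x : E, HasSum (fun i => taylorPoly (h i : E → ℂ) j x) (taylorPoly g j x)) :
    Summable (expTerm k ρ g) ∧ expNorm k ρ g ≤ ∑' i, expNorm k ρ (h i : E → ℂ) := by
  have hρ0 : 0 < ρ := A.coe_nonneg.trans_lt hρ
  let F : ι × ℕ → ℝ := fun x => expTerm k ρ (h x.1 : E → ℂ) x.2
  have hF0 : 0 ≤ F := fun x => expTerm_nonneg k hρ0.le _ _
  -- Nonnegative terms: summability over pairs allows the order of summation to be exchanged.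
  have hF : Summable F := (summable_prod_of_nonneg hF0).mpr ⟨fun i => (h i).summable hρ, hs⟩
  have hF' : Summable (fun x : ℕ × ι => F x.swap) := hF.prod_symm
  obtain ⟨h1, h2⟩ := (summable_prod_of_nonneg (fun x => hF0 x.swap)).mp hF'
  have hle : ∀ j, expTerm k ρ g j ≤ ∑' i, F (i, j) := by
    intro j
    have hc : 0 < (ρ ^ j)⁻¹ * weight k j := mul_pos (by positivity) (weight_pos k j)
    have hsj : Summable fun i => polyNorm (taylorPoly (h i : E → ℂ) j) :=
      (summable_mul_left_iff hc.ne').mp (h1 j)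
    have : ∑' i, F (i, j) = (ρ ^ j)⁻¹ * weight k j * ∑' i, polyNorm (taylorPoly (h i : E → ℂ) j) := by
      rw [← tsum_mul_left]
      rfl
    rw [this]
    refine mul_le_mul_of_nonneg_left (polyNorm_le fun x hx => ?_) hc.le
    rw [← (hg j x).tsum_eq]
    exact tsum_of_norm_bounded hsj.hasSum fun i => norm_taylorPoly_le_polyNorm _ _ hx
  have hsum := Summable.of_nonneg_of_le (expTerm_nonneg k hρ0.le g) hle h2
  refine ⟨hsum, (hsum.tsum_le_tsum hle h2).trans (le_of_eq ?_)⟩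
  exact (Summable.tsum_comm (f := fun j i => F (i, j)) hF').symm

/-- Completeness is not needed, as the limit is given. The remainder after a finite partial sum has
the Taylor polynomials of the complementary family, so its norm is at most the tail of the series of
norms. -/
theorem ExpSpace.hasSum_of_taylorPoly {ι : Type*} {h : ι → ExpSpace k A E} {g : ExpSpace k A E}
    (hs : ∀ ρ : ℝ, (A : ℝ) < ρ → Summable fun i => expNorm k ρ (h i : E → ℂ))
    (hg : ∀ j, ∀ x : E, HasSum (fun i => taylorPoly (h i : E → ℂ) j x)
      (taylorPoly (g : E → ℂ) j x)) : HasSum h g := by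
  classical
  refine (withSeminorms_expSeminorm.tendsto_nhds _ g).mpr fun ρ ε hε => ?_
  have h0 := tendsto_tsum_compl_atTop_zero fun i => expNorm k ρ.1 (h i : E → ℂ)
  filter_upwards [h0.eventually (gt_mem_nhds hε)] with s hsε
  rw [map_sub_rev]
  refine lt_of_le_of_lt ?_ hsε
  refine (summable_expTerm_of_hasSum (h := fun i : {i // i ∉ s} => h i) ρ.2
    ((hs ρ.1 ρ.2).subtype _) fun j x => ?_).2
  have := (Finset.hasSum_compl_iff s (f := fun i => taylorPoly (h i : E → ℂ) j x)
    (a := taylorLin k A j x (g - ∑ i ∈ s, h i))).mpr ?_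
  · exact this
  rw [map_sub, map_sum]
  change HasSum _ (taylorLin k A j x g - ∑ i ∈ s, taylorLin k A j x (h i)
    + ∑ i ∈ s, taylorLin k A j x (h i))
  rw [sub_add_cancel]
  exact hg j x


end Space

/-! ### Entire functions along complex lines -/

section EntireTaylor

variable {E : Type*} [NormedAddCommGroup E] [NormedSpace ℂ E]

/-- A power series converging to `f` on the whole space. -/
theorem hasFPowerSeriesOnBall_top {f : E → ℂ} {p : FormalMultilinearSeries ℂ E ℂ}
    (hp : ∀ r : ℝ≥0, Summable fun n => ‖p n‖ * (r : ℝ) ^ n)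
    (hf : ∀ x, HasSum (fun n => p n fun _ => x) (f x)) : HasFPowerSeriesOnBall f p 0 ∞ where
  r_le := (p.radius_eq_top_of_summable_norm hp).ge
  r_pos := by simp
  hasSum := fun {y} _ => by simpa using hf y

theorem iteratedFDeriv_diag_eq_iteratedDeriv {f : E → ℂ} (hf : AnalyticOnNhd ℂ f Set.univ)
    (j : ℕ) (x : E) :
    iteratedFDeriv ℂ j f 0 (fun _ => x) = iteratedDeriv j (fun t : ℂ => f (t • x)) 0 := by
  have h := ContinuousLinearMap.iteratedFDeriv_comp_right (n := ⊤)
    ((ContinuousLinearMap.id ℂ ℂ).smulRight x) hf.contDiff 0 (i := j) le_top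
  have h2 : (fun t : ℂ => f (t • x)) = f ∘ ((ContinuousLinearMap.id ℂ ℂ).smulRight x) := by
    ext t; simp
  rw [iteratedDeriv_eq_iteratedFDeriv, h2, h]
  simp

theorem differentiable_line {f : E → ℂ} (hf : AnalyticOnNhd ℂ f Set.univ) (x : E) :
    Differentiable ℂ fun t : ℂ => f (t • x) := fun t =>
  (hf (t • x) trivial).differentiableAt.comp t (by fun_prop)

theorem hasSum_taylorPoly {f : E → ℂ} (hf : AnalyticOnNhd ℂ f Set.univ) (x : E) :
    HasSum (fun j => taylorPoly f j x) (f x) := by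
  have h := Complex.hasSum_taylorSeries_of_entire (differentiable_line hf x) 0 1
  simpa [taylorPoly, iteratedFDeriv_diag_eq_iteratedDeriv hf] using h

/-- Cauchy's estimate in one variable, on the disc of radius `R` for `t ↦ f (t • x)` with `x` in the
unit ball. -/
theorem polyNorm_taylorPoly_le {f : E → ℂ} (hf : AnalyticOnNhd ℂ f Set.univ) {R C : ℝ}
    (hR : 0 < R) (hC : ∀ x, ‖x‖ ≤ R → ‖f x‖ ≤ C) (j : ℕ) :
    polyNorm (taylorPoly f j) ≤ C / R ^ j := by
  refine polyNorm_le fun x hx => ?_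
  rw [taylorPoly, iteratedFDeriv_diag_eq_iteratedDeriv hf, norm_mul, norm_inv,
    Complex.norm_natCast]
  have h := Complex.norm_iteratedDeriv_le_of_forall_mem_sphere_norm_le (c := 0) (C := C) j hR
    (differentiable_line hf x).diffContOnCl fun z hz => hC _ ?_
  · calc _ ≤ (j.factorial : ℝ)⁻¹ * (j.factorial * C / R ^ j) := by gcongr
      _ = _ := by
        have : (j.factorial : ℝ) ≠ 0 := by exact_mod_cast j.factorial_ne_zero
        field_simp
  · rw [norm_smul, mem_sphere_zero_iff_norm.mp hz]
    exact mul_le_of_le_one_right hR.le hx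

end EntireTaylor

/-! ### Entire functions as elements of the space -/

section OfEntire

variable {k : ℝ≥0∞} {A : ℝ≥0} {E : Type*} [NormedAddCommGroup E] [NormedSpace ℂ E]

theorem expTerm_congr {ρ : ℝ} {f g : E → ℂ} (h : ∀ j x, taylorPoly f j x = taylorPoly g j x) :
    expTerm k ρ f = expTerm k ρ g := by
  ext j
  rw [expTerm, expTerm, funext (h j)]

theorem indicator_expDomain_eventuallyEq (f : E → ℂ) :
    (expDomain E k A).indicator f =ᶠ[𝓝 0] f := by
  filter_upwards [(isOpen_expDomain k A).mem_nhds (zero_mem_expDomain k A)] with x hx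
  simp [hx]

/-- The element of `Exp^k_{0,A}(E)` given by a function which is analytic on all of `E`. -/
noncomputable def ExpSpace.ofEntire (f : E → ℂ) (hf : AnalyticOnNhd ℂ f Set.univ)
    (hs : ∀ ρ : ℝ, (A : ℝ) < ρ → Summable (expTerm k ρ f)) : ExpSpace k A E :=
  ⟨(expDomain E k A).indicator f, fun x hx => Set.indicator_of_notMem hx _, fun x hx => by
    refine (hf x trivial).congr ?_
    filter_upwards [(isOpen_expDomain k A).mem_nhds hx] with y hy
    simp [hy], fun ρ hρ => by
    rw [expTerm_congr (g := f) fun j x =>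
      taylorPoly_congr (indicator_expDomain_eventuallyEq f) j x]
    exact hs ρ hρ⟩

@[simp]
theorem ExpSpace.taylorPoly_ofEntire (f : E → ℂ) (hf : AnalyticOnNhd ℂ f Set.univ)
    (hs : ∀ ρ : ℝ, (A : ℝ) < ρ → Summable (expTerm k ρ f)) (j : ℕ) (x : E) :
    taylorPoly (ExpSpace.ofEntire f hf hs : ExpSpace k A E) j x = taylorPoly f j x :=
  taylorPoly_congr (indicator_expDomain_eventuallyEq f) j x

@[simp]
theorem ExpSpace.expNorm_ofEntire (f : E → ℂ) (hf : AnalyticOnNhd ℂ f Set.univ)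
    (hs : ∀ ρ : ℝ, (A : ℝ) < ρ → Summable (expTerm k ρ f)) (ρ : ℝ) :
    expNorm k ρ (ExpSpace.ofEntire f hf hs : ExpSpace k A E) = expNorm k ρ f := by
  rw [expNorm, expTerm_congr (ExpSpace.taylorPoly_ofEntire f hf hs), expNorm]

theorem ExpSpace.ofEntire_apply (f : E → ℂ) (hf : AnalyticOnNhd ℂ f Set.univ)
    (hs : ∀ ρ : ℝ, (A : ℝ) < ρ → Summable (expTerm k ρ f)) {x : E} (hx : x ∈ expDomain E k A) :
    (ExpSpace.ofEntire f hf hs : ExpSpace k A E) x = f x :=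
  Set.indicator_of_mem hx _

end OfEntire

/-! ### Homogeneous polynomials and Taylor expansion in the space -/

section Polynomials

variable {k : ℝ≥0∞} {A : ℝ≥0} {E : Type*} [NormedAddCommGroup E] [NormedSpace ℂ E]

theorem hasFPowerSeriesOnBall_diag {j : ℕ} (q : E [×j]→L[ℂ] ℂ) :
    HasFPowerSeriesOnBall (fun x => q fun _ => x)
      (Pi.single j q : ∀ n, E [×n]→L[ℂ] ℂ) 0 ∞ := by
  refine hasFPowerSeriesOnBall_top (fun r => ?_) fun x => ?_
  · refine summable_of_ne_finset_zero (s := {j}) fun b hb => ?_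
    rw [Pi.single_eq_of_ne (by simpa using hb)]
    simp
  · have := hasSum_single (f := fun n => (Pi.single j q : ∀ n, E [×n]→L[ℂ] ℂ) n fun _ => x) j
      fun b hb => by
        rw [Pi.single_eq_of_ne hb]
        simp
    simpa using this

theorem analyticOnNhd_diag {j : ℕ} (q : E [×j]→L[ℂ] ℂ) :
    AnalyticOnNhd ℂ (fun x => q fun _ => x) Set.univ := fun x _ =>
  (hasFPowerSeriesOnBall_diag q).analyticOnNhd x (by simp)

theorem taylorPoly_diag_self {j : ℕ} (q : E [×j]→L[ℂ] ℂ) (x : E) :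
    taylorPoly (fun x => q fun _ => x) j x = q fun _ => x := by
  rw [taylorPoly_of_hasFPowerSeriesAt (hasFPowerSeriesOnBall_diag q).hasFPowerSeriesAt]
  simp

theorem taylorPoly_diag_of_ne {j : ℕ} (q : E [×j]→L[ℂ] ℂ) {i : ℕ} (h : i ≠ j) (x : E) :
    taylorPoly (fun x => q fun _ => x) i x = 0 := by
  rw [taylorPoly_of_hasFPowerSeriesAt (hasFPowerSeriesOnBall_diag q).hasFPowerSeriesAt,
    Pi.single_eq_of_ne h]
  simp

theorem expTerm_diag_of_ne {ρ : ℝ} {j : ℕ} (q : E [×j]→L[ℂ] ℂ) {i : ℕ} (h : i ≠ j) :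
    expTerm k ρ (fun x => q fun _ => x) i = 0 := by
  rw [expTerm, funext (taylorPoly_diag_of_ne q h)]
  simp [polyNorm]

theorem hasSum_expTerm_diag (k : ℝ≥0∞) (ρ : ℝ) {j : ℕ} (q : E [×j]→L[ℂ] ℂ) :
    HasSum (expTerm k ρ fun x => q fun _ => x)
      ((ρ ^ j)⁻¹ * weight k j * polyNorm fun x => q fun _ => x) := by
  have := hasSum_single j fun i (hi : i ≠ j) => expTerm_diag_of_ne (k := k) (ρ := ρ) q hi
  rwa [expTerm, funext (taylorPoly_diag_self q)] at this

variable (k A) in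
/-- Homogeneous polynomials as elements of `Exp^k_{0,A}(E)`. -/
noncomputable def homPoly (j : ℕ) : (E [×j]→L[ℂ] ℂ) →ₗ[ℂ] ExpSpace k A E where
  toFun q := ExpSpace.ofEntire (fun x => q fun _ => x) (analyticOnNhd_diag q)
    fun ρ _ => (hasSum_expTerm_diag k ρ q).summable
  map_add' _ _ := Subtype.ext (Set.indicator_add _ _ _)
  map_smul' c _ := Subtype.ext (Set.indicator_const_smul _ c _)

theorem homPoly_apply {j : ℕ} (q : E [×j]→L[ℂ] ℂ) :
    homPoly k A j q = ExpSpace.ofEntire (fun x => q fun _ => x) (analyticOnNhd_diag q)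
      fun ρ _ => (hasSum_expTerm_diag k ρ q).summable := rfl

/-- A multilinear form enters only through its diagonal, so it may be replaced by any form,
symmetric or not, with the same diagonal. -/
theorem homPoly_congr {j : ℕ} {p q : E [×j]→L[ℂ] ℂ} (h : ∀ x, (p fun _ => x) = q fun _ => x) :
    homPoly k A j p = homPoly k A j q :=
  Subtype.ext (congrArg (Set.indicator _) (funext h))

theorem taylorPoly_homPoly_self {j : ℕ} (q : E [×j]→L[ℂ] ℂ) (x : E) :
    taylorPoly (homPoly k A j q) j x = q fun _ => x := by
  rw [homPoly_apply, ExpSpace.taylorPoly_ofEntire, taylorPoly_diag_self]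

theorem taylorPoly_homPoly_of_ne {j : ℕ} (q : E [×j]→L[ℂ] ℂ) {i : ℕ} (h : i ≠ j) (x : E) :
    taylorPoly (homPoly k A j q) i x = 0 := by
  rw [homPoly_apply, ExpSpace.taylorPoly_ofEntire, taylorPoly_diag_of_ne q h]

theorem expNorm_homPoly {ρ : ℝ} {j : ℕ} (q : E [×j]→L[ℂ] ℂ) :
    expNorm k ρ (homPoly k A j q) = (ρ ^ j)⁻¹ * weight k j * polyNorm fun x => q fun _ => x := by
  rw [homPoly_apply, ExpSpace.expNorm_ofEntire]
  exact (hasSum_expTerm_diag k ρ q).tsum_eq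

theorem expNorm_homPoly_le {ρ : ℝ} (hρ : 0 < ρ) {j : ℕ} (q : E [×j]→L[ℂ] ℂ) :
    expNorm k ρ (homPoly k A j q) ≤ (ρ ^ j)⁻¹ * weight k j * ‖q‖ := by
  rw [expNorm_homPoly]
  have := weight_nonneg k j
  gcongr
  refine polyNorm_le fun x hx => (q.le_opNorm _).trans ?_
  simpa using mul_le_of_le_one_right (norm_nonneg q) (pow_le_one₀ (norm_nonneg _) hx)

/-- Elements of `Exp^k_{0,A}(E)` are the sums of their Taylor series. -/
theorem ExpSpace.hasSum_homPoly (f : ExpSpace k A E) :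
    HasSum (fun j => homPoly k A j ((j.factorial : ℂ)⁻¹ • iteratedFDeriv ℂ j (f : E → ℂ) 0)) f := by
  have h : ∀ j x, ((j.factorial : ℂ)⁻¹ • iteratedFDeriv ℂ j (f : E → ℂ) 0) (fun _ => x)
      = taylorPoly (f : E → ℂ) j x := fun j x => rfl
  refine ExpSpace.hasSum_of_taylorPoly (fun ρ hρ => ?_) fun l x => ?_
  · refine (f.summable hρ).congr fun j => ?_
    rw [expNorm_homPoly, funext (h j)]
    rfl
  · have := hasSum_single (f := fun j => taylorPoly (homPoly k A j
      ((j.factorial : ℂ)⁻¹ • iteratedFDeriv ℂ j (f : E → ℂ) 0)) l x) l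
        fun j hj => taylorPoly_homPoly_of_ne _ hj.symm x
    rwa [taylorPoly_homPoly_self, h] at this

variable (E) in
/-- The map sending linear forms `ξ₁, …, ξⱼ` to their product `(x₁, …, xⱼ) ↦ ∏ ξᵢ(xᵢ)`. -/
noncomputable def prodForms (j : ℕ) : (E →L[ℂ] ℂ) [×j]→L[ℂ] (E [×j]→L[ℂ] ℂ) :=
  (ContinuousLinearMap.apply ℂ (E [×j]→L[ℂ] ℂ)
    (ContinuousMultilinearMap.mkPiAlgebra ℂ (Fin j) ℂ)).compContinuousMultilinearMap
    (ContinuousMultilinearMap.compContinuousLinearMapContinuousMultilinear ℂ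
      (fun _ : Fin j => E) (fun _ : Fin j => ℂ) ℂ)

@[simp]
theorem prodForms_apply (j : ℕ) (ξ : Fin j → E →L[ℂ] ℂ) (x : Fin j → E) :
    prodForms E j ξ x = ∏ i, ξ i (x i) := by
  simp [prodForms]

theorem norm_prodForms_le (j : ℕ) : ‖prodForms E j‖ ≤ 1 := by
  refine ContinuousMultilinearMap.opNorm_le_bound zero_le_one fun ξ => ?_
  refine ContinuousMultilinearMap.opNorm_le_bound (by positivity) fun x => ?_
  rw [prodForms_apply, norm_prod, one_mul, ← Finset.prod_mul_distrib]
  gcongr with i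
  exact (ξ i).le_opNorm (x i)

/-- On a finite-dimensional space products of linear forms span all homogeneous polynomials. -/
theorem homPoly_eq_zero_of_prodForms [FiniteDimensional ℂ E] {F : Type*} [AddCommGroup F]
    [Module ℂ F] (T : ExpSpace k A E →ₗ[ℂ] F) {j : ℕ}
    (hT : ∀ ξ, T (homPoly k A j (prodForms E j ξ)) = 0) (q : E [×j]→L[ℂ] ℂ) :
    T (homPoly k A j q) = 0 := by
  let b := Module.finBasis ℂ E
  let c : Fin (Module.finrank ℂ E) → E →L[ℂ] ℂ := fun i => (b.coord i).toContinuousLinearMap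
  -- Expanding every argument in a finite basis writes the form as a combination of products of
  -- coordinate forms.
  have h : homPoly k A j q = homPoly k A j
      (∑ r : Fin j → Fin (Module.finrank ℂ E), q (fun i => b (r i)) •
        prodForms E j (fun i => c (r i))) := by
    refine homPoly_congr fun x => ?_
    have hx : (fun _ : Fin j => x) = fun _ => ∑ l, c l x • b l := by
      funext _
      exact (b.sum_repr x).symm
    conv_lhs => rw [hx, q.map_sum]
    simp [ContinuousMultilinearMap.map_smul_univ, mul_comm]
  rw [h, map_sum, map_sum]
  exact Finset.sum_eq_zero fun r _ => by rw [map_smul, map_smul, hT, smul_zero]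

end Polynomials

/-! ### Exponentials and the density of their span -/

section Exponentials

variable {k : ℝ≥0∞} {A : ℝ≥0} {E : Type*} [NormedAddCommGroup E] [NormedSpace ℂ E]

/-- Up to the exponent `1/k` the weight is `(j/(ke))^j`, which is at most `(j/e)^j`, hence at most
`j!` because `j^j / j!` is a term of the series of `e^j`. -/
theorem weight_le_factorial_rpow (hk : 1 < k) (hk' : k ≠ ∞) (j : ℕ) :
    weight k j ≤ (j.factorial : ℝ) ^ (k.toReal)⁻¹ := by
  have hr : 1 < k.toReal := by
    simpa using (ENNReal.toReal_lt_toReal ENNReal.one_ne_top hk').mpr hk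
  have he := Real.exp_pos 1
  rw [weight, if_neg hk', div_eq_mul_inv (j : ℝ) k.toReal, Real.rpow_mul (by positivity),
    Real.rpow_natCast]
  gcongr
  have h := Real.pow_div_factorial_le_exp (x := j) (by positivity) j
  have hj : (0 : ℝ) < j.factorial := by exact_mod_cast j.factorial_pos
  calc ((j : ℝ) / (k.toReal * Real.exp 1)) ^ j ≤ ((j : ℝ) / (1 * Real.exp 1)) ^ j := by gcongr
    _ = (j : ℝ) ^ j / Real.exp j := by
      rw [one_mul, div_pow, ← Real.exp_nat_mul, mul_one]
    _ ≤ j.factorial := by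
      rw [div_le_iff₀ (Real.exp_pos _)]
      rwa [div_le_iff₀ hj, mul_comm] at h

/-- Here `k > 1` is decisive: for finite `k` the exponent is `θ = 1 - 1/k`, so a positive power of
the factorial is left over to beat every geometric growth. -/
theorem exists_weight_div_factorial_le (hk : 1 < k) :
    ∃ θ : ℝ, 0 < θ ∧ ∀ j, weight k j / j.factorial ≤ ((j.factorial : ℝ) ^ θ)⁻¹ := by
  by_cases hk' : k = ∞
  · exact ⟨1, one_pos, fun j => by simp [weight, hk']⟩
  have hr : 1 < k.toReal := by
    simpa using (ENNReal.toReal_lt_toReal ENNReal.one_ne_top hk').mpr hk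
  refine ⟨1 - (k.toReal)⁻¹, sub_pos.mpr (inv_lt_one_of_one_lt₀ hr), fun j => ?_⟩
  have hj : (0 : ℝ) < j.factorial := by exact_mod_cast j.factorial_pos
  rw [← Real.rpow_neg hj.le, neg_sub, Real.rpow_sub_one hj.ne']
  gcongr
  exact weight_le_factorial_rpow hk hk' j

theorem summable_pow_div_factorial_rpow {θ : ℝ} (hθ : 0 < θ) {r : ℝ} (hr : 0 < r) :
    Summable fun j : ℕ => r ^ j * ((j.factorial : ℝ) ^ θ)⁻¹ := by
  have hpos : ∀ j : ℕ, (0 : ℝ) < (j.factorial : ℝ) := fun j => by exact_mod_cast j.factorial_pos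
  refine summable_of_ratio_test_tendsto_lt_one zero_lt_one
    (Filter.Eventually.of_forall fun j => ?_) ?_
  · have := hpos j
    positivity
  have h : ∀ j : ℕ, ‖r ^ (j + 1) * (((j + 1).factorial : ℝ) ^ θ)⁻¹‖
      / ‖r ^ j * ((j.factorial : ℝ) ^ θ)⁻¹‖ = r * (((j + 1 : ℕ) : ℝ) ^ θ)⁻¹ := by
    intro j
    have h1 := hpos j
    have h2 : (0 : ℝ) < ((j + 1 : ℕ) : ℝ) := by positivity
    have h3 := Real.rpow_pos_of_pos h1 θ
    have h4 := Real.rpow_pos_of_pos h2 θ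
    rw [Nat.factorial_succ, Nat.cast_mul, Real.mul_rpow h2.le h1.le,
      Real.norm_of_nonneg (by positivity), Real.norm_of_nonneg (by positivity)]
    rw [pow_succ]
    field_simp
  simp_rw [h]
  have : Filter.Tendsto (fun j : ℕ => (((j + 1 : ℕ) : ℝ) ^ θ)⁻¹) Filter.atTop (𝓝 0) :=
    ((tendsto_rpow_atTop hθ).comp (tendsto_natCast_atTop_atTop.comp
      (Filter.tendsto_add_atTop_nat 1))).inv_tendsto_atTop
  simpa using this.const_mul r

theorem summable_weight_pow_div_factorial (hk : 1 < k) {r : ℝ} (hr : 0 ≤ r) :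
    Summable fun j : ℕ => weight k j * r ^ j / j.factorial := by
  obtain ⟨θ, hθ, h⟩ := exists_weight_div_factorial_le hk
  refine Summable.of_nonneg_of_le (fun j => ?_) (fun j => ?_)
    (summable_pow_div_factorial_rpow hθ (r := r + 1) (by positivity))
  · have := weight_nonneg k j
    positivity
  · have := weight_nonneg k j
    calc weight k j * r ^ j / j.factorial = r ^ j * (weight k j / j.factorial) := by ring
      _ ≤ (r + 1) ^ j * ((j.factorial : ℝ) ^ θ)⁻¹ := by
        gcongr
        · linarith
        · exact h j

theorem analyticOnNhd_cexp_comp (ξ : E →L[ℂ] ℂ) :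
    AnalyticOnNhd ℂ (fun x => Complex.exp (ξ x)) Set.univ := fun x _ =>
  (ξ.analyticAt x).cexp

theorem taylorPoly_cexp_comp (ξ : E →L[ℂ] ℂ) (j : ℕ) (x : E) :
    taylorPoly (fun x => Complex.exp (ξ x)) j x = (j.factorial : ℂ)⁻¹ * ξ x ^ j := by
  rw [taylorPoly, iteratedFDeriv_diag_eq_iteratedDeriv (analyticOnNhd_cexp_comp ξ)]
  have : (fun t : ℂ => Complex.exp (ξ (t • x))) = fun t => Complex.exp (ξ x * t) := by
    ext t
    rw [map_smul, smul_eq_mul, mul_comm]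
  rw [this, iteratedDeriv_cexp_const_mul]
  simp

theorem summable_expTerm_cexp_comp (hk : 1 < k) (ξ : E →L[ℂ] ℂ) {ρ : ℝ} (hρ : 0 < ρ) :
    Summable (expTerm k ρ fun x => Complex.exp (ξ x)) := by
  refine Summable.of_nonneg_of_le (expTerm_nonneg k hρ.le _) (fun j => ?_)
    (summable_weight_pow_div_factorial hk (r := ‖ξ‖ / ρ) (by positivity))
  have hp : polyNorm (taylorPoly (fun x => Complex.exp (ξ x)) j)
      ≤ (j.factorial : ℝ)⁻¹ * ‖ξ‖ ^ j := by
    refine polyNorm_le fun x hx => ?_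
    rw [taylorPoly_cexp_comp, norm_mul, norm_inv, Complex.norm_natCast, norm_pow]
    gcongr
    exact (ξ.le_opNorm x).trans (mul_le_of_le_one_right (norm_nonneg _) hx)
  have := weight_nonneg k j
  calc expTerm k ρ (fun x => Complex.exp (ξ x)) j
      ≤ (ρ ^ j)⁻¹ * weight k j * ((j.factorial : ℝ)⁻¹ * ‖ξ‖ ^ j) := by
        unfold expTerm; gcongr
    _ = _ := by rw [div_pow]; field_simp

/-- The exponential `x ↦ exp (ξ x)` as an element of `Exp^k_{0,A}(E)`. -/
noncomputable def expVec (A : ℝ≥0) (hk : 1 < k) (ξ : E →L[ℂ] ℂ) : ExpSpace k A E :=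
  ExpSpace.ofEntire (fun x => Complex.exp (ξ x)) (analyticOnNhd_cexp_comp ξ)
    fun _ hρ => summable_expTerm_cexp_comp hk ξ (A.coe_nonneg.trans_lt hρ)

theorem hasSum_expVec (hk : 1 < k) (ξ : E →L[ℂ] ℂ) :
    HasSum (fun j => (j.factorial : ℂ)⁻¹ • homPoly k A j (prodForms E j fun _ => ξ))
      (expVec A hk ξ) := by
  convert (expVec A hk ξ).hasSum_homPoly using 2 with j
  rw [← map_smul]
  refine homPoly_congr fun x => ?_
  have : taylorPoly (expVec A hk ξ : E → ℂ) j x = (j.factorial : ℂ)⁻¹ * ξ x ^ j := by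
    simp [expVec, taylorPoly_cexp_comp]
  rw [_root_.smul_apply, _root_.smul_apply]
  simpa [taylorPoly] using this.symm

/-- A linear functional on `Exp^k_{0,A}(E)`, restricted to homogeneous polynomials. -/
theorem exists_clm_homPoly (T : ExpSpace k A E →L[ℂ] ℂ) :
    ∃ ρ : ℝ, 0 < ρ ∧ ∃ C : ℝ, 0 ≤ C ∧ ∀ j, ∃ S : (E [×j]→L[ℂ] ℂ) →L[ℂ] ℂ,
      (∀ q, S q = T (homPoly k A j q)) ∧ ‖S‖ ≤ C * ((ρ ^ j)⁻¹ * weight k j) := by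
  obtain ⟨ρ, hρ, C, hC, h⟩ := ExpSpace.exists_norm_le T
  have hρ0 : 0 < ρ := A.coe_nonneg.trans_lt hρ
  refine ⟨ρ, hρ0, C, hC, fun j => ?_⟩
  have hb : 0 ≤ C * ((ρ ^ j)⁻¹ * weight k j) :=
    mul_nonneg hC (mul_nonneg (by positivity) (weight_nonneg k j))
  refine ⟨((T : ExpSpace k A E →ₗ[ℂ] ℂ) ∘ₗ homPoly k A j).mkContinuous
    (C * ((ρ ^ j)⁻¹ * weight k j)) fun q => ?_, fun q => rfl,
    LinearMap.mkContinuous_norm_le _ hb _⟩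
  refine (h _).trans ?_
  rw [mul_assoc]
  exact mul_le_mul_of_nonneg_left (expNorm_homPoly_le hρ0 q) hC

/-- The Fourier–Borel transform `ξ ↦ T (exp ∘ ξ)` is entire, with the obvious power series. -/
theorem exists_hasFPowerSeries_expVec (hk : 1 < k) (T : ExpSpace k A E →L[ℂ] ℂ) :
    ∃ p : FormalMultilinearSeries ℂ (E →L[ℂ] ℂ) ℂ,
      HasFPowerSeriesOnBall (fun ξ => T (expVec A hk ξ)) p 0 ∞ ∧
      ∀ j ξ, p j ξ = (j.factorial : ℂ)⁻¹ * T (homPoly k A j (prodForms E j ξ)) := by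
  obtain ⟨ρ, hρ, C, hC, h⟩ := exists_clm_homPoly T
  choose S hS hSn using h
  let p : FormalMultilinearSeries ℂ (E →L[ℂ] ℂ) ℂ := fun j =>
    ((j.factorial : ℂ)⁻¹ • S j).compContinuousMultilinearMap (prodForms E j)
  have hp : ∀ j ξ, p j ξ = (j.factorial : ℂ)⁻¹ * T (homPoly k A j (prodForms E j ξ)) := by
    intro j ξ
    simp [p, hS]
  refine ⟨p, hasFPowerSeriesOnBall_top (fun r => ?_) fun ξ => ?_, hp⟩
  · refine Summable.of_nonneg_of_le (fun j => by positivity) (fun j => ?_)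
      ((summable_weight_pow_div_factorial hk (r := r / ρ) (by positivity)).mul_left C)
    have hw := weight_nonneg k j
    have h1 : ‖p j‖ ≤ (j.factorial : ℝ)⁻¹ * (C * ((ρ ^ j)⁻¹ * weight k j)) := by
      refine (ContinuousLinearMap.norm_compContinuousMultilinearMap_le _ _).trans ?_
      refine (mul_le_of_le_one_right (norm_nonneg _) (norm_prodForms_le j)).trans ?_
      rw [norm_smul, norm_inv, Complex.norm_natCast]
      gcongr
      exact hSn j
    calc ‖p j‖ * (r : ℝ) ^ j
        ≤ (j.factorial : ℝ)⁻¹ * (C * ((ρ ^ j)⁻¹ * weight k j)) * (r : ℝ) ^ j := by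
          gcongr
      _ = _ := by rw [div_pow]; field_simp
  · simp_rw [hp]
    convert (hasSum_expVec hk ξ).mapL T using 2
    simp

theorem analyticOnNhd_expVec (hk : 1 < k) (T : ExpSpace k A E →L[ℂ] ℂ) :
    AnalyticOnNhd ℂ (fun ξ => T (expVec A hk ξ)) Set.univ := by
  obtain ⟨p, hp, -⟩ := exists_hasFPowerSeries_expVec hk T
  exact fun ξ _ => hp.analyticOnNhd ξ (by simp)

/-- A functional vanishing on the exponentials of an open set of linear forms is zero. -/
theorem eq_zero_of_expVec [FiniteDimensional ℂ E] (hk : 1 < k) (T : ExpSpace k A E →L[ℂ] ℂ)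
    {W : Set (E →L[ℂ] ℂ)} (hW : IsOpen W) (hne : W.Nonempty)
    (hT : ∀ ξ ∈ W, T (expVec A hk ξ) = 0) : T = 0 := by
  obtain ⟨ξ₀, hξ₀⟩ := hne
  have h0 : (fun ξ => T (expVec A hk ξ)) = 0 := by
    -- Identity theorem: vanishing near one linear form propagates to the whole dual space.
    refine (analyticOnNhd_expVec hk T).eq_of_eventuallyEq analyticOnNhd_const (z₀ := ξ₀) ?_
    filter_upwards [hW.mem_nhds hξ₀] with ξ hξ using hT ξ hξ
  obtain ⟨p, hp, hpT⟩ := exists_hasFPowerSeries_expVec hk T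
  rw [h0] at hp
  have hfac : ∀ j : ℕ, (j.factorial : ℂ) ≠ 0 := fun j => by exact_mod_cast j.factorial_ne_zero
  have hprod : ∀ j ξ, T (homPoly k A j (prodForms E j ξ)) = 0 := by
    intro j ξ
    -- The derivative of the zero function is the sum of `p j` over all permutations of its
    -- arguments. Since `p j` is already symmetric, this is `j!` times `p j`, which must therefore
    -- vanish.
    have h := hp.iteratedFDeriv_eq_sum (analyticOnNhd_const.analyticOn) ξ
    have hsymm : ∀ σ : Equiv.Perm (Fin j), (p j fun i => ξ (σ i)) = p j ξ := by
      intro σ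
      rw [hpT, hpT]
      congr 2
      refine homPoly_congr fun x => ?_
      simp only [prodForms_apply]
      exact Equiv.prod_comp σ fun i => ξ i x
    have hz : iteratedFDeriv ℂ j (0 : (E →L[ℂ] ℂ) → ℂ) 0 = 0 := by simp
    rw [hz, Finset.sum_congr rfl fun σ _ => hsymm σ, hpT] at h
    simpa [Fintype.card_perm, hfac] using h.symm
  have hpoly : ∀ j q, T (homPoly k A j q) = 0 := fun j =>
    homPoly_eq_zero_of_prodForms (T : ExpSpace k A E →ₗ[ℂ] ℂ) (hprod j)
  refine ContinuousLinearMap.ext fun f => ?_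
  have h1 := (f.hasSum_homPoly).mapL T
  simp_rw [hpoly] at h1
  exact h1.unique hasSum_zero

/-- A subspace of a locally convex space annihilated only by zero is dense. -/
theorem dense_of_forall_dual {X : Type*} [TopologicalSpace X] [AddCommGroup X] [Module ℂ X]
    [IsTopologicalAddGroup X] [ContinuousSMul ℂ X] [LocallyConvexSpace ℝ X] (S : Submodule ℂ X)
    (h : ∀ T : X →L[ℂ] ℂ, (∀ x ∈ S, T x = 0) → T = 0) : Dense (S : Set X) := by
  by_contra hS
  obtain ⟨x, hx⟩ : ∃ x, x ∉ closure (S : Set X) := by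
    by_contra! hx
    exact hS hx
  have : ContinuousConstSMul ℝ X := ⟨fun c => by
    simpa using (continuous_const_smul (c : ℂ) : Continuous fun x : X => (c : ℂ) • x)⟩
  obtain ⟨T, u, hu, hux⟩ := RCLike.geometric_hahn_banach_closed_point (𝕜 := ℂ)
    ((S.restrictScalars ℝ).convex.closure) isClosed_closure hx
  have hu0 : 0 < u := by simpa using hu 0 (subset_closure S.zero_mem)
  have hT : ∀ y ∈ S, T y = 0 := by
    intro y hy
    by_contra hy0
    -- This multiple of `y` stays in the subspace but is sent by `T` exactly to `u`, contradicting
    -- the strict bound.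
    have := hu (((u : ℂ) * (T y)⁻¹) • y) (subset_closure (S.smul_mem _ hy))
    rw [map_smul, smul_eq_mul, inv_mul_cancel_right₀ hy0] at this
    simp at this
  rw [h T hT] at hux
  simp at hux
  linarith

theorem dense_span_expVec [FiniteDimensional ℂ E] (hk : 1 < k) {W : Set (E →L[ℂ] ℂ)}
    (hW : IsOpen W) (hne : W.Nonempty) :
    Dense (Submodule.span ℂ (expVec A hk '' W) : Set (ExpSpace k A E)) :=
  dense_of_forall_dual _ fun T hT => eq_zero_of_expVec hk T hW hne fun ξ hξ =>
    hT _ (Submodule.subset_span ⟨ξ, hξ, rfl⟩)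

end Exponentials

/-! ### The eigenvalue criterion for mixing -/

section Eigenvectors

variable {X : Type*} [TopologicalSpace X] [AddCommGroup X] [Module ℂ X]

theorem iterate_eigenvector {T : X →L[ℂ] X} {x : X} {c : ℂ} (h : T x = c • x) (n : ℕ) :
    (⇑T)^[n] x = c ^ n • x := by
  induction n with
  | zero => simp
  | succ n ih => rw [Function.iterate_succ_apply', ih, map_smul, h, smul_smul, pow_succ]

theorem iterate_map_smul_clm (T : X →L[ℂ] X) (n : ℕ) (a : ℂ) (x : X) :
    (⇑T)^[n] (a • x) = a • (⇑T)^[n] x := by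
  induction n with
  | zero => rfl
  | succ n ih => rw [Function.iterate_succ_apply', ih, map_smul, Function.iterate_succ_apply']

variable [IsTopologicalAddGroup X] [ContinuousSMul ℂ X]

theorem tendsto_iterate_of_mem_span (T : X →L[ℂ] X) {ι : Type*} {e : ι → X} {c : ι → ℂ}
    (he : ∀ i, T (e i) = c i • e i) {x : X}
    (hx : x ∈ Submodule.span ℂ (e '' {i | ‖c i‖ < 1})) :
    Filter.Tendsto (fun n => (⇑T)^[n] x) Filter.atTop (𝓝 0) := by
  induction hx using Submodule.span_induction with
  | mem x hx =>
    obtain ⟨i, hi, rfl⟩ := hx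
    simp_rw [iterate_eigenvector (he i)]
    simpa using (tendsto_pow_atTop_nhds_zero_of_norm_lt_one hi).smul_const (e i)
  | zero => simpa [iterate_map_zero] using tendsto_const_nhds
  | add x y _ _ hx hy => simpa [iterate_map_add] using hx.add hy
  | smul a x _ hx =>
    simpa [iterate_map_smul_clm] using hx.const_smul a

/-- On an eigenvector one divides by `c ^ n`. The preimages are chosen for each vector separately,
so no right inverse, linear or well defined on the span, has to be constructed. -/
theorem exists_backward_of_mem_span (T : X →L[ℂ] X) {ι : Type*} {e : ι → X} {c : ι → ℂ}
    (he : ∀ i, T (e i) = c i • e i) {x : X}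
    (hx : x ∈ Submodule.span ℂ (e '' {i | 1 < ‖c i‖})) :
    ∃ w : ℕ → X, Filter.Tendsto w Filter.atTop (𝓝 0) ∧ ∀ n, (⇑T)^[n] (w n) = x := by
  induction hx using Submodule.span_induction with
  | mem x hx =>
    obtain ⟨i, hi, rfl⟩ := hx
    have hi0 : c i ≠ 0 := norm_pos_iff.mp (one_pos.trans hi)
    have hi1 : ‖(c i)⁻¹‖ < 1 := by
      rw [norm_inv]
      exact inv_lt_one_of_one_lt₀ hi
    refine ⟨fun n => (c i)⁻¹ ^ n • e i, ?_, fun n => ?_⟩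
    · simpa using (tendsto_pow_atTop_nhds_zero_of_norm_lt_one hi1).smul_const (e i)
    · rw [iterate_map_smul_clm, iterate_eigenvector (he i), smul_smul, ← mul_pow,
        inv_mul_cancel₀ hi0, one_pow, one_smul]
  | zero => exact ⟨0, tendsto_const_nhds, fun n => by simp [iterate_map_zero]⟩
  | add x y _ _ hx hy =>
    obtain ⟨u, hu, hu'⟩ := hx
    obtain ⟨v, hv, hv'⟩ := hy
    exact ⟨fun n => u n + v n, by simpa using hu.add hv, fun n => by simp [iterate_map_add, hu', hv']⟩
  | smul a x _ hx =>
    obtain ⟨u, hu, hu'⟩ := hx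
    refine ⟨fun n => a • u n, by simpa using hu.const_smul a, fun n => ?_⟩
    rw [iterate_map_smul_clm, hu']

/-- The Godefroy–Shapiro criterion. -/
theorem isMixing_of_eigenvectors (T : X →L[ℂ] X) {ι : Type*} {e : ι → X} {c : ι → ℂ}
    (he : ∀ i, T (e i) = c i • e i)
    (h₁ : Dense (Submodule.span ℂ (e '' {i | ‖c i‖ < 1}) : Set X))
    (h₂ : Dense (Submodule.span ℂ (e '' {i | 1 < ‖c i‖}) : Set X)) : IsMixing T := by
  intro U V hU hV hUne hVne
  obtain ⟨u, huU, hu⟩ := h₁.exists_mem_open hU hUne |>.imp fun _ h => h.symm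
  obtain ⟨v, hvV, hv⟩ := h₂.exists_mem_open hV hVne |>.imp fun _ h => h.symm
  have hTu := tendsto_iterate_of_mem_span T he hu
  obtain ⟨w, hw, hTw⟩ := exists_backward_of_mem_span T he hv
  -- The points `u + w n` tend to `u`, while `T^n` sends them to `T^n u + v`, which tends to `v`.
  have hU' : ∀ᶠ n in Filter.atTop, u + w n ∈ U := by
    have : Filter.Tendsto (fun n => u + w n) Filter.atTop (𝓝 u) := by
      simpa using hw.const_add u
    exact this.eventually (hU.mem_nhds huU)
  have hV' : ∀ᶠ n in Filter.atTop, (⇑T)^[n] u + v ∈ V := by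
    have : Filter.Tendsto (fun n => (⇑T)^[n] u + v) Filter.atTop (𝓝 v) := by
      simpa using hTu.add_const v
    exact this.eventually (hV.mem_nhds hvV)
  obtain ⟨N, hN⟩ := Filter.eventually_atTop.mp (hU'.and hV')
  refine ⟨N, fun n hn => ⟨_, ⟨u + w n, (hN n hn).1, rfl⟩, ?_⟩⟩
  rw [iterate_map_add, hTw]
  exact (hN n hn).2

end Eigenvectors

/-! ### Liouville's theorem: small and large values -/

section Liouville

variable {F : Type*} [NormedAddCommGroup F] [NormedSpace ℂ F]

/-- Otherwise `1/φ` would be entire and bounded by one. -/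
theorem exists_norm_lt_one_of_nonconstant {φ : F → ℂ} (hφ : Differentiable ℂ φ)
    (hne : ¬ ∃ c, ∀ x, φ x = c) : ∃ x, ‖φ x‖ < 1 := by
  by_contra! h
  have h0 : ∀ x, φ x ≠ 0 := fun x => norm_pos_iff.mp (one_pos.trans_le (h x))
  have hb : Bornology.IsBounded (Set.range fun x => (φ x)⁻¹) := by
    refine (Metric.isBounded_closedBall (x := (0 : ℂ)) (r := 1)).subset ?_
    rintro _ ⟨x, rfl⟩
    simpa using inv_le_one_of_one_le₀ (h x)
  refine hne ⟨φ 0, fun x => inv_injective ?_⟩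
  exact (hφ.inv h0).apply_eq_apply_of_bounded hb x 0

theorem exists_one_lt_norm_of_nonconstant {φ : F → ℂ} (hφ : Differentiable ℂ φ)
    (hne : ¬ ∃ c, ∀ x, φ x = c) : ∃ x, 1 < ‖φ x‖ := by
  by_contra! h
  have hb : Bornology.IsBounded (Set.range φ) := by
    refine (Metric.isBounded_closedBall (x := (0 : ℂ)) (r := 1)).subset ?_
    rintro _ ⟨x, rfl⟩
    simpa using h x
  exact hne ⟨φ 0, fun x => hφ.apply_eq_apply_of_bounded hb x 0⟩

end Liouville

/-! ### Convolution operators are mixing -/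

section Convolution

variable {k : ℝ≥0∞} {A : ℝ≥0} {E : Type*} [NormedAddCommGroup E] [NormedSpace ℂ E]

theorem isPreconnected_expDomain : IsPreconnected (expDomain E k A) := by
  unfold expDomain
  split_ifs
  · have h := ((convexOn_univ_norm (E := E)).smul A.coe_nonneg).convex_lt 1
    simpa using h.isPreconnected
  · exact isPreconnected_univ

/-- The function vanishes near the origin, hence on its connected domain, and off the domain by
convention. -/
theorem ExpSpace.eq_zero_of_taylorPoly {f : ExpSpace k A E}
    (h : ∀ j x, taylorPoly (f : E → ℂ) j x = 0) : f = 0 := by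
  obtain ⟨p, hp⟩ := f.analyticAt_zero
  have h0 : (f : E → ℂ) =ᶠ[𝓝 0] 0 := by
    filter_upwards [hp.eventually_hasSum] with x hx
    simp_rw [← taylorPoly_of_hasFPowerSeriesAt hp, h, zero_add] at hx
    exact hx.unique hasSum_zero
  have h1 := f.2.2.1.eqOn_zero_of_preconnected_of_eventuallyEq_zero isPreconnected_expDomain
    (zero_mem_expDomain k A) h0
  refine ExpSpace.ext fun x => ?_
  by_cases hx : x ∈ expDomain E k A
  · exact h1 hx
  · exact f.2.1 x hx

/-- Needed so that continuous operators agreeing on a dense set coincide. Positivity of the weights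
lets a single norm separate points. -/
instance : T2Space (ExpSpace k A E) := by
  have : T1Space (ExpSpace k A E) := by
    refine withSeminorms_expSeminorm.T1_of_separating fun f hf => ?_
    by_contra! h
    refine hf (ExpSpace.eq_zero_of_taylorPoly fun j x => ?_)
    obtain ⟨ρ⟩ : Nonempty {ρ : ℝ // (A : ℝ) < ρ} := inferInstance
    have hρ0 : 0 < ρ.1 := A.coe_nonneg.trans_lt ρ.2
    have hs := (f.summable ρ.2).hasSum
    rw [show ∑' j, expTerm k ρ.1 (f : E → ℂ) j = 0 from h ρ,
      hasSum_zero_iff_of_nonneg (expTerm_nonneg k hρ0.le _)] at hs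
    have hj : (ρ.1 ^ j)⁻¹ * weight k j * polyNorm (taylorPoly (f : E → ℂ) j) = 0 := congrFun hs j
    have hc : 0 < (ρ.1 ^ j)⁻¹ * weight k j := mul_pos (by positivity) (weight_pos k j)
    have hp := (mul_eq_zero.mp hj).resolve_left hc.ne'
    simpa [hp] using norm_taylorPoly_le_polyNorm_mul (f : E → ℂ) j x
  infer_instance

variable (k A E) in
/-- The functional `δ₀ : f ↦ f(0)`. -/
noncomputable def evalZero : ExpSpace k A E →L[ℂ] ℂ where
  toFun f := (f : E → ℂ) 0
  map_add' _ _ := rfl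
  map_smul' _ _ := rfl
  cont := by
    let T : ExpSpace k A E →ₗ[ℂ] ℂ :=
      { toFun := fun f => (f : E → ℂ) 0, map_add' := fun _ _ => rfl, map_smul' := fun _ _ => rfl }
    refine ExpSpace.continuous_of_norm_le T (ρ := A + 1) (by simp) (C := 1) fun f => ?_
    have h := norm_taylorPoly_le_polyNorm (f : E → ℂ) 0 (x := 0) (by simp)
    have hA : (A : ℝ) < A + 1 := by simp
    have h0 := (f.summable hA).le_tsum 0 fun j _ => expTerm_nonneg k (by positivity) _ j
    simp only [expTerm, pow_zero, inv_one, one_mul] at h0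
    have hw : weight k 0 = 1 := by simp [weight]
    rw [hw, one_mul] at h0
    rw [one_mul]
    refine le_trans ?_ (h.trans h0)
    simp [taylorPoly]
    rfl

theorem dirDeriv_expVec (hk : 1 < k) (ξ : E →L[ℂ] ℂ) (a : E) :
    (expVec A hk ξ).dirDeriv a = ξ a • expVec A hk ξ := by
  refine ExpSpace.ext fun x => ?_
  change dirDerivOn (expDomain E k A) _ a x = ξ a * (expVec A hk ξ : E → ℂ) x
  by_cases hx : x ∈ expDomain E k A
  · have h : (expVec A hk ξ : E → ℂ) =ᶠ[𝓝 x] fun y => Complex.exp (ξ y) := by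
      filter_upwards [(isOpen_expDomain k A).mem_nhds hx] with y hy
      exact ExpSpace.ofEntire_apply _ _ _ hy
    have h2 : HasFDerivAt (fun y => Complex.exp (ξ y)) (Complex.exp (ξ x) • ξ) x :=
      ξ.hasFDerivAt.cexp
    simp only [dirDerivOn, Set.indicator_of_mem hx]
    rw [h.fderiv_eq, h2.fderiv, h.eq_of_nhds]
    simp [mul_comm]
  · rw [dirDerivOn, Set.indicator_of_notMem hx, (expVec A hk ξ).2.1 x hx, mul_zero]

/-- Joint eigenvectors of the directional derivatives are exponentials. -/
theorem eq_smul_expVec_of_dirDeriv (hk : 1 < k) (ξ : E →L[ℂ] ℂ) (g : ExpSpace k A E)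
    (hg : ∀ a, g.dirDeriv a = ξ a • g) : g = (g : E → ℂ) 0 • expVec A hk ξ := by
  set U := expDomain E k A with hU
  -- Multiplying by `exp (-ξ)` turns the eigenvalue equation into the vanishing of the derivative on
  -- a connected open set.
  have hd : ∀ x ∈ U, HasFDerivAt (fun y => (g : E → ℂ) y * Complex.exp (-ξ y))
      (0 : E →L[ℂ] ℂ) x := by
    intro x hx
    have h1 := (g.2.2.1 x hx).differentiableAt.hasFDerivAt
    have h2 : HasFDerivAt (fun y => Complex.exp (-ξ y)) (Complex.exp (-ξ x) • (-ξ)) x :=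
      (ξ.hasFDerivAt (x := x)).neg.cexp
    refine (h1.mul h2).congr_fderiv (ContinuousLinearMap.ext fun a => ?_)
    have h3 : fderiv ℂ (g : E → ℂ) x a = ξ a * (g : E → ℂ) x := by
      have : dirDerivOn U (g : E → ℂ) a x = ξ a * (g : E → ℂ) x :=
        congrFun (congrArg Subtype.val (hg a)) x
      rwa [dirDerivOn, Set.indicator_of_mem hx] at this
    simp [h3]
    ring
  refine ExpSpace.ext fun x => ?_
  change (g : E → ℂ) x = (g : E → ℂ) 0 * (expVec A hk ξ : E → ℂ) x
  by_cases hx : x ∈ U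
  · have h := (isOpen_expDomain k A).is_const_of_fderiv_eq_zero isPreconnected_expDomain
      (fun y hy => (hd y hy).differentiableAt.differentiableWithinAt)
      (fun y hy => (hd y hy).fderiv) hx (zero_mem_expDomain k A)
    simp only [map_zero, neg_zero, Complex.exp_zero, mul_one] at h
    have h1 : (expVec A hk ξ : E → ℂ) x = Complex.exp (ξ x) := ExpSpace.ofEntire_apply _ _ _ hx
    rw [← h, h1, mul_assoc, ← Complex.exp_add, neg_add_cancel, Complex.exp_zero, mul_one]
  · rw [g.2.1 x hx, (expVec A hk ξ).2.1 x hx, mul_zero]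

/-- Nontrivial convolution operators on `Exp^k_{0,A}(E)` are mixing. -/
theorem isMixing_of_isConvolutionOperator [FiniteDimensional ℂ E] (hk : 1 < k)
    {L : ExpSpace k A E →L[ℂ] ExpSpace k A E} (hL : IsConvolutionOperator L)
    (hne : IsNontrivial L) : IsMixing L := by
  -- The eigenvalue is recovered by evaluating at the origin, where every exponential equals one;
  -- this displays it as the transform of a continuous functional, hence as an entire function.
  let φ : (E →L[ℂ] ℂ) → ℂ := fun ξ => (evalZero k A E ∘L L) (expVec A hk ξ)
  have hφ : Differentiable ℂ φ := fun ξ =>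
    (analyticOnNhd_expVec hk (evalZero k A E ∘L L) ξ trivial).differentiableAt
  have he : ∀ ξ, L (expVec A hk ξ) = φ ξ • expVec A hk ξ := by
    intro ξ
    refine eq_smul_expVec_of_dirDeriv hk ξ _ fun a => ?_
    rw [hL, dirDeriv_expVec, map_smul]
  -- A constant eigenvalue would make `L` a scalar on the dense span of all exponentials.
  have hconst : ¬ ∃ c, ∀ ξ, φ ξ = c := by
    rintro ⟨c, hc⟩
    refine hne ⟨c, fun f => ?_⟩
    have hdense := dense_span_expVec (A := A) hk (E := E) isOpen_univ Set.univ_nonempty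
    have h := ContinuousLinearMap.ext_on hdense (f := L)
      (g := c • ContinuousLinearMap.id ℂ (ExpSpace k A E)) (by
        rintro _ ⟨ξ, -, rfl⟩
        simp [he, hc])
    rw [h]
    rfl
  refine isMixing_of_eigenvectors L he (dense_span_expVec hk ?_ ?_) (dense_span_expVec hk ?_ ?_)
  · exact isOpen_lt hφ.continuous.norm continuous_const
  · exact exists_norm_lt_one_of_nonconstant hφ hconst
  · exact isOpen_lt continuous_const hφ.continuous.norm
  · exact exists_one_lt_norm_of_nonconstant hφ hconst

end Convolution

/-! ### From mixing to hypercyclicity -/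

section Birkhoff

variable {X Y : Type*} [TopologicalSpace X] [AddCommMonoid X] [Module ℂ X]
  [TopologicalSpace Y] [AddCommMonoid Y] [Module ℂ Y]

theorem IsMixing.of_semiconj (e : X ≃L[ℂ] Y) {T : X →L[ℂ] X} {S : Y →L[ℂ] Y}
    (h : ∀ x, e (T x) = S (e x)) (hT : IsMixing T) : IsMixing S := by
  intro U V hU hV hUne hVne
  obtain ⟨N, hN⟩ := hT (e ⁻¹' U) (e ⁻¹' V) (hU.preimage e.continuous) (hV.preimage e.continuous)
    (hUne.preimage e.surjective) (hVne.preimage e.surjective)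
  refine ⟨N, fun n hn => ?_⟩
  obtain ⟨_, ⟨x, hx, rfl⟩, hx'⟩ := hN n hn
  refine ⟨e ((⇑T)^[n] x), ⟨e x, hx, ?_⟩, hx'⟩
  exact ((Function.Semiconj.iterate_right (f := e) (ga := ⇑T) (gb := ⇑S) h n) x).symm

/-- Birkhoff's transitivity theorem. -/
theorem IsMixing.isHypercyclic [BaireSpace X] [SecondCountableTopology X] {T : X →L[ℂ] X}
    (hT : IsMixing T) : IsHypercyclic T := by
  -- The points whose orbit meets every basic open set: a countable intersection of open sets, each
  -- dense by mixing.
  have hdense : Dense (⋂ V ∈ TopologicalSpace.countableBasis X, ⋃ n : ℕ, (⇑T)^[n] ⁻¹' V) := by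
    refine dense_biInter_of_isOpen (fun V hV => isOpen_iUnion fun n => ?_)
      (TopologicalSpace.countable_countableBasis X) fun V hV => ?_
    · exact (TopologicalSpace.isOpen_of_mem_countableBasis hV).preimage (T.continuous.iterate n)
    · refine dense_iff_inter_open.mpr fun U hU hUne => ?_
      obtain ⟨N, hN⟩ := hT U V hU (TopologicalSpace.isOpen_of_mem_countableBasis hV) hUne
        (TopologicalSpace.nonempty_of_mem_countableBasis hV)
      obtain ⟨_, ⟨x, hx, rfl⟩, hx'⟩ := hN N le_rfl
      exact ⟨x, hx, Set.mem_iUnion.mpr ⟨N, hx'⟩⟩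
  obtain ⟨x, hx⟩ := hdense.nonempty
  refine ⟨x, (TopologicalSpace.isBasis_countableBasis X).dense_iff.mpr fun V hV _ => ?_⟩
  obtain ⟨n, hn⟩ := Set.mem_iUnion.mp (Set.mem_iInter₂.mp hx V hV)
  exact ⟨_, hn, n, rfl⟩

end Birkhoff

/-! ### The space of entire functions -/

section EntireEquiv

variable {E : Type*} [NormedAddCommGroup E] [NormedSpace ℂ E]

@[simp]
theorem expDomain_zero (k : ℝ≥0∞) : expDomain E k 0 = Set.univ := by
  simp [expDomain]

theorem ExpSpace.analyticOnNhd {k : ℝ≥0∞} (f : ExpSpace k 0 E) :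
    AnalyticOnNhd ℂ (f : E → ℂ) Set.univ := by
  simpa using f.2.2.1

/-- Cauchy's estimate on the ball of radius `2/ρ`: the extra factor two over `1/ρ` makes the terms a
geometric series. It gives membership in the space and one half of the comparison of topologies. -/
theorem hasSum_geometric_bound_expTerm {f : E → ℂ} (hf : AnalyticOnNhd ℂ f Set.univ) {ρ C : ℝ}
    (hρ : 0 < ρ) (hC : ∀ x, ‖x‖ ≤ 2 / ρ → ‖f x‖ ≤ C) :
    Summable (expTerm ∞ ρ f) ∧ expNorm ∞ ρ f ≤ C * 2 := by
  have hg : HasSum (fun j : ℕ => C * (1 / 2 : ℝ) ^ j) (C * 2) := hasSum_geometric_two.mul_left C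
  have hle : ∀ j, expTerm ∞ ρ f j ≤ C * (1 / 2 : ℝ) ^ j := by
    intro j
    have h := polyNorm_taylorPoly_le hf (R := 2 / ρ) (by positivity) hC j
    calc expTerm ∞ ρ f j ≤ (ρ ^ j)⁻¹ * 1 * (C / (2 / ρ) ^ j) := by
          simp only [expTerm, weight, if_true]
          gcongr
      _ = _ := by
        rw [div_pow, div_pow, one_pow]
        field_simp
  have hs := Summable.of_nonneg_of_le (expTerm_nonneg ∞ hρ.le f) hle hg.summable
  exact ⟨hs, (hs.tsum_le_tsum hle hg.summable).trans_eq hg.tsum_eq⟩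

/-- The other half of the comparison: on the ball of radius `1/ρ` the Taylor series is dominated
term by term by the norm. -/
theorem ExpSpace.norm_apply_le (f : ExpSpace ∞ 0 E) {ρ : ℝ} (hρ : 0 < ρ) {x : E}
    (hx : ‖x‖ ≤ ρ⁻¹) : ‖(f : E → ℂ) x‖ ≤ expNorm ∞ ρ (f : E → ℂ) := by
  rw [← (hasSum_taylorPoly f.analyticOnNhd x).tsum_eq]
  refine tsum_of_norm_bounded (f.summable (by simpa using hρ)).hasSum fun j => ?_
  refine (norm_taylorPoly_le_polyNorm_mul _ j x).trans ?_
  have := polyNorm_nonneg (taylorPoly (f : E → ℂ) j)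
  calc polyNorm (taylorPoly (f : E → ℂ) j) * ‖x‖ ^ j
      ≤ polyNorm (taylorPoly (f : E → ℂ) j) * ρ⁻¹ ^ j := by gcongr
    _ = _ := by simp [expTerm, weight, mul_comm]

theorem EntireSpace.eventually_norm_lt {R ε : ℝ} [ProperSpace E] (hε : 0 < ε)
    {ι : Type*} {l : Filter ι} {u : ι → C(E, ℂ)} {f : C(E, ℂ)} (hu : Filter.Tendsto u l (𝓝 f)) :
    ∀ᶠ n in l, ∀ x, ‖x‖ ≤ R → ‖u n x - f x‖ < ε := by
  have h := ContinuousMap.tendsto_iff_forall_isCompact_tendstoUniformlyOn.mp hu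
    (Metric.closedBall 0 R) (isCompact_closedBall 0 R)
  filter_upwards [Metric.tendstoUniformlyOn_iff.mp h ε hε] with n hn x hx
  rw [← dist_eq_norm, dist_comm]
  exact hn x (by simpa using hx)

theorem exists_norm_le_of_continuous [ProperSpace E] (f : C(E, ℂ)) (R : ℝ) :
    ∃ C : ℝ, 0 ≤ C ∧ ∀ x, ‖x‖ ≤ R → ‖f x‖ ≤ C := by
  obtain ⟨C, hC⟩ := (isCompact_closedBall (0 : E) R).exists_bound_of_continuousOn
    f.continuous.continuousOn
  exact ⟨max C 0, le_max_right _ _, fun x hx => (hC x (by simpa using hx)).trans (le_max_left _ _)⟩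

variable (E) in
/-- `Exp^∞_{0,0}(E)` and `H(E)` have the same elements. -/
noncomputable def entireLinearEquiv [ProperSpace E] : ExpSpace ∞ 0 E ≃ₗ[ℂ] EntireSpace E where
  toFun f := ⟨⟨f, continuousOn_univ.mp f.analyticOnNhd.continuousOn⟩, f.analyticOnNhd⟩
  map_add' _ _ := rfl
  map_smul' _ _ := rfl
  invFun f := ⟨f.1, by simp, fun x _ => f.2 x trivial, fun ρ hρ => by
    obtain ⟨C, -, hC⟩ := exists_norm_le_of_continuous f.1 (2 / ρ)
    exact (hasSum_geometric_bound_expTerm f.2 (by simpa using hρ) hC).1⟩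
  left_inv _ := rfl
  right_inv _ := rfl

instance : ContinuousAdd (EntireSpace E) :=
  inferInstanceAs (ContinuousAdd (EntireSpace E).toAddSubmonoid)

variable (E) in
/-- `Exp^∞_{0,0}(E) = H(E)` as topological vector spaces. -/
noncomputable def entireEquiv [ProperSpace E] : ExpSpace ∞ 0 E ≃L[ℂ] EntireSpace E where
  toLinearEquiv := entireLinearEquiv E
  continuous_toFun := by
    refine continuous_of_continuousAt_zero (entireLinearEquiv E) ?_
    rw [ContinuousAt, map_zero, tendsto_subtype_rng,
      ContinuousMap.tendsto_iff_forall_isCompact_tendstoUniformlyOn]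
    intro K hK
    refine Metric.tendstoUniformlyOn_iff.mpr fun ε hε => ?_
    obtain ⟨R, hR, hKR⟩ := hK.isBounded.exists_pos_norm_le
    have hR' : ((0 : ℝ≥0) : ℝ) < R⁻¹ := by simpa using hR
    have h := (withSeminorms_expSeminorm.continuous_seminorm
      (p := expSeminorm ∞ 0 E) ⟨R⁻¹, hR'⟩).tendsto 0
    rw [map_zero] at h
    filter_upwards [h.eventually (gt_mem_nhds hε)] with f hf x hx
    rw [dist_comm]
    change dist ((f : E → ℂ) x) 0 < ε
    rw [dist_zero_right]
    exact (f.norm_apply_le (inv_pos.mpr hR) (by simpa using hKR x hx)).trans_lt hf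
  continuous_invFun := by
    refine continuous_of_continuousAt_zero (entireLinearEquiv E).symm ?_
    rw [ContinuousAt, map_zero]
    refine (withSeminorms_expSeminorm.tendsto_nhds _ _).mpr fun ρ ε hε => ?_
    have hρ : 0 < ρ.1 := by simpa using ρ.2
    have h := EntireSpace.eventually_norm_lt (R := 2 / ρ.1) (ε := ε / 4) (by positivity)
      (continuous_subtype_val.tendsto (0 : EntireSpace E))
    filter_upwards [h] with f hf
    rw [sub_zero]
    have := (hasSum_geometric_bound_expTerm f.2 hρ (C := ε / 4) fun x hx => by
      simpa using (hf x hx).le).2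
    exact this.trans_lt (by linarith)

theorem entireEquiv_dirDeriv [ProperSpace E] (a : E) (f : ExpSpace ∞ 0 E) :
    entireEquiv E (f.dirDeriv a) = EntireSpace.dirDeriv a (entireEquiv E f) := by
  refine Subtype.ext (ContinuousMap.ext fun x => ?_)
  change dirDerivOn (expDomain E ∞ 0) (f : E → ℂ) a x = fderiv ℂ (f : E → ℂ) x a
  simp [dirDerivOn]

theorem isMixing_of_isConvolutionOperatorEntire [FiniteDimensional ℂ E]
    {L : EntireSpace E →L[ℂ] EntireSpace E} (hL : IsConvolutionOperatorEntire L)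
    (hne : IsNontrivial L) : IsMixing L := by
  have : ProperSpace E := FiniteDimensional.proper ℂ E
  let e := entireEquiv E
  let L' : ExpSpace ∞ 0 E →L[ℂ] ExpSpace ∞ 0 E := (e.symm : _ →L[ℂ] _) ∘L L ∘L (e : _ →L[ℂ] _)
  have h : ∀ f, e (L' f) = L (e f) := fun f => e.apply_symm_apply _
  refine IsMixing.of_semiconj e h (isMixing_of_isConvolutionOperator (by simp) ?_ ?_)
  · intro a f
    apply e.injective
    rw [entireEquiv_dirDeriv, h, h, hL, entireEquiv_dirDeriv]
  · rintro ⟨c, hc⟩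
    refine hne ⟨c, fun f => ?_⟩
    have := h (e.symm f)
    rwa [hc, map_smul, e.apply_symm_apply, eq_comm] at this

theorem norm_smul_form_le {j : ℕ} (c : ℂ) (q : E [×j]→L[ℂ] ℂ) : ‖c • q‖ ≤ ‖c‖ * ‖q‖ := by
  refine ContinuousMultilinearMap.opNorm_le_bound (by positivity) fun v => ?_
  rw [_root_.smul_apply, norm_smul, mul_assoc]
  exact mul_le_mul_of_nonneg_left (q.le_opNorm v) (norm_nonneg c)

/-- Locally uniform limits of entire functions are entire. -/
theorem analyticOnNhd_of_tendsto [ProperSpace E] {u : ℕ → C(E, ℂ)} {f : C(E, ℂ)}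
    (hu : Filter.Tendsto u Filter.atTop (𝓝 f)) (hua : ∀ n, AnalyticOnNhd ℂ (u n) Set.univ) :
    AnalyticOnNhd ℂ (f : E → ℂ) Set.univ := by
  have hua0 : ∀ n, AnalyticAt ℂ (u n) 0 := fun n => hua n 0 trivial
  have hbound : ∀ R : ℝ, ∃ M : ℝ, 0 ≤ M ∧ ∀ᶠ n in Filter.atTop, ∀ x, ‖x‖ ≤ R → ‖u n x‖ ≤ M := by
    intro R
    obtain ⟨M, hM, hfM⟩ := exists_norm_le_of_continuous f R
    refine ⟨M + 1, by positivity, ?_⟩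
    filter_upwards [EntireSpace.eventually_norm_lt (R := R) one_pos hu] with n hn x hx
    have := norm_le_norm_add_norm_sub' (u n x) (f x)
    linarith [hn x hx, hfM x hx]
  -- Uniform closeness on the unit ball, Cauchy's estimate and the polarization bound `K` control
  -- the difference of the full derivatives.
  have hcauchy : ∀ j, CauchySeq fun n => iteratedFDeriv ℂ j (u n) 0 := by
    intro j
    set K : ℝ := j.factorial * (2 * Real.exp 1) ^ j with hK
    have hK0 : 0 < K := by positivity
    refine Metric.cauchySeq_iff.mpr fun ε hε => ?_
    obtain ⟨N, hN⟩ := Filter.eventually_atTop.mp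
      (EntireSpace.eventually_norm_lt (R := 1) (ε := ε / (4 * K)) (by positivity) hu)
    refine ⟨N, fun m hm n hn => ?_⟩
    have hd : AnalyticOnNhd ℂ ((u m : E → ℂ) - (u n : E → ℂ)) Set.univ := (hua m).sub (hua n)
    have h1 := norm_iteratedFDeriv_le_polyNorm (hd 0 trivial) j
    have h2 := polyNorm_taylorPoly_le hd one_pos (C := ε / (2 * K)) (fun x hx => by
      have h3 := hN m hm x hx
      have h4 := hN n hn x hx
      have h5 : u m x - u n x = (u m x - f x) - (u n x - f x) := by ring
      have h6 : ε / (2 * K) = ε / (4 * K) + ε / (4 * K) := by field_simp; ring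
      rw [Pi.sub_apply, h5, h6]
      exact (norm_sub_le _ _).trans (add_le_add h3.le h4.le)) j
    rw [one_pow, div_one] at h2
    rw [iteratedFDeriv_sub_apply (hua0 m).contDiffAt (hua0 n).contDiffAt] at h1
    rw [dist_eq_norm]
    calc _ ≤ K * (ε / (2 * K)) := h1.trans (mul_le_mul_of_nonneg_left h2 hK0.le)
      _ = ε / 2 := by field_simp
      _ < ε := by linarith
  choose q hq using fun j => cauchySeq_tendsto_of_complete (hcauchy j)
  let p : FormalMultilinearSeries ℂ E ℂ := fun j => (j.factorial : ℂ)⁻¹ • q j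
  have hpt : ∀ j x, Filter.Tendsto (fun n => taylorPoly (u n) j x) Filter.atTop
      (𝓝 (p j fun _ => x)) := by
    intro j x
    have := ((ContinuousMultilinearMap.apply ℂ (fun _ : Fin j => E) ℂ
      (fun _ => x)).continuous.tendsto _).comp (hq j)
    exact this.const_mul _
  have hpn : ∀ r : ℝ≥0, Summable fun n => ‖p n‖ * (r : ℝ) ^ n := by
    intro r
    -- Chosen so that the polarization factor `2e` times `r + 1`, divided by `R`, is one half.
    set R : ℝ := 4 * Real.exp 1 * (r + 1) with hR
    have hR0 : 0 < R := by positivity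
    obtain ⟨M, hM, hMu⟩ := hbound R
    refine Summable.of_nonneg_of_le (fun j => by positivity) (fun j => ?_)
      (summable_geometric_two.mul_left M)
    have h1 : ‖q j‖ ≤ j.factorial * (2 * Real.exp 1) ^ j * (M / R ^ j) := by
      refine le_of_tendsto (hq j).norm ?_
      filter_upwards [hMu] with n hn
      refine (norm_iteratedFDeriv_le_polyNorm (hua0 n) j).trans ?_
      gcongr
      exact polyNorm_taylorPoly_le (hua n) hR0 hn j
    have h2 : ‖p j‖ ≤ (j.factorial : ℝ)⁻¹ * ‖q j‖ := by
      refine (norm_smul_form_le _ (q j)).trans_eq ?_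
      rw [norm_inv, Complex.norm_natCast]
    have hj : (0 : ℝ) < j.factorial := by exact_mod_cast j.factorial_pos
    calc ‖p j‖ * (r : ℝ) ^ j
        ≤ ((j.factorial : ℝ)⁻¹ * (j.factorial * (2 * Real.exp 1) ^ j * (M / R ^ j)))
            * ((r : ℝ) + 1) ^ j := by
          gcongr
          · exact h2.trans (by gcongr)
          · linarith
      _ = M * ((2 * Real.exp 1) * ((r : ℝ) + 1) / R) ^ j := by
          clear_value R
          generalize (r : ℝ) + 1 = s
          rw [div_pow, mul_pow _ s, mul_assoc (j.factorial : ℝ),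
            inv_mul_cancel_left₀ hj.ne']
          ring
      _ = M * (1 / 2) ^ j := by
          congr 2
          rw [hR]
          field_simp
          norm_num
  have hsum : ∀ x, HasSum (fun n => p n fun _ => x) (f x) := by
    intro x
    set R : ℝ := 2 * ‖x‖ + 1 with hR
    have hR0 : 0 < R := by positivity
    obtain ⟨M, hM, hMu⟩ := hbound R
    have hq1 : ‖x‖ / R < 1 := (div_lt_one hR0).mpr (by linarith [norm_nonneg x])
    have hbs : Summable fun j : ℕ => M * (‖x‖ / R) ^ j :=
      (summable_geometric_of_lt_one (by positivity) hq1).mul_left M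
    have hle : ∀ᶠ n in Filter.atTop, ∀ j, ‖taylorPoly (u n) j x‖ ≤ M * (‖x‖ / R) ^ j := by
      filter_upwards [hMu] with n hn j
      refine (norm_taylorPoly_le_polyNorm_mul _ j x).trans ?_
      calc _ ≤ M / R ^ j * ‖x‖ ^ j := by
            gcongr
            exact polyNorm_taylorPoly_le (hua n) hR0 hn j
        _ = _ := by rw [div_pow]; ring
    -- The pointwise limit is interchanged with the Taylor sum; the majorant is geometric because
    -- `R` exceeds `‖x‖`.
    have h1 := tendsto_tsum_of_dominated_convergence hbs (fun j => hpt j x) hle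
    have h2 : Filter.Tendsto (fun n => u n x) Filter.atTop (𝓝 (f x)) :=
      ((continuous_eval_const x).tendsto f).comp hu
    simp_rw [fun n => (hasSum_taylorPoly (hua n) x).tsum_eq] at h1
    rw [tendsto_nhds_unique h2 h1]
    refine (Summable.of_norm_bounded hbs fun j => ?_).hasSum
    exact le_of_tendsto (hpt j x).norm (hle.mono fun n hn => hn j)
  exact fun x _ => (hasFPowerSeriesOnBall_top hpn hsum).analyticOnNhd x (by simp)

theorem isClosed_entireSpace [FiniteDimensional ℂ E] : IsClosed (EntireSpace E : Set C(E, ℂ)) := by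
  have : ProperSpace E := FiniteDimensional.proper ℂ E
  refine isClosed_of_closure_subset fun f hf => ?_
  obtain ⟨u, hu, hlim⟩ := mem_closure_iff_seq_limit.mp hf
  exact analyticOnNhd_of_tendsto hlim hu

theorem isHypercyclic_of_isConvolutionOperatorEntire [FiniteDimensional ℂ E]
    {L : EntireSpace E →L[ℂ] EntireSpace E} (hL : IsConvolutionOperatorEntire L)
    (hne : IsNontrivial L) : IsHypercyclic L := by
  have : ProperSpace E := FiniteDimensional.proper ℂ E
  have : CompleteSpace (EntireSpace E) := isClosed_entireSpace.completeSpace_coe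
  have : (uniformity (EntireSpace E)).IsCountablyGenerated :=
    Filter.comap.isCountablyGenerated _ _
  have : SecondCountableTopology (EntireSpace E) :=
    inferInstanceAs (SecondCountableTopology {f : C(E, ℂ) // f ∈ EntireSpace E})
  exact (isMixing_of_isConvolutionOperatorEntire hL hne).isHypercyclic

end EntireEquiv

/-! ### Growth of the weights -/

section Weights

variable {k : ℝ≥0∞}

/-- The exponents add up, and enlarging both bases to that of `i + j` only increases the powers. -/
theorem weight_mul_le (hk : 1 < k) (i j : ℕ) : weight k i * weight k j ≤ weight k (i + j) := by
  by_cases hk' : k = ∞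
  · simp [weight, hk']
  have hr : 0 < k.toReal := ENNReal.toReal_pos (zero_lt_one.trans hk).ne' hk'
  rcases Nat.eq_zero_or_pos (i + j) with h | h
  · obtain ⟨rfl, rfl⟩ : i = 0 ∧ j = 0 := by omega
    simp [weight]
  have hij : (0 : ℝ) < ((i + j : ℕ) : ℝ) := by exact_mod_cast h
  have he := Real.exp_pos 1
  simp only [weight, if_neg hk']
  have hadd : ((i + j : ℕ) : ℝ) / k.toReal = (i : ℝ) / k.toReal + (j : ℝ) / k.toReal := by
    push_cast; ring
  rw [hadd, Real.rpow_add (by positivity)]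
  gcongr <;> simp

theorem exists_inv_weight_le (k : ℝ≥0∞) : ∃ C : ℝ, 0 ≤ C ∧ ∀ j, (weight k j)⁻¹ ≤ C ^ j := by
  obtain ⟨C, hC, h⟩ := exists_weight_le k
  refine ⟨C, hC, fun j => ?_⟩
  rw [inv_le_iff_one_le_mul₀ (weight_pos k j)]
  induction j with
  | zero => simp [weight]
  | succ j ih =>
    calc (1 : ℝ) ≤ C ^ j * weight k j := ih
      _ ≤ C ^ j * (C * weight k (j + 1)) := by gcongr; exact h j
      _ = C ^ (j + 1) * weight k (j + 1) := by ring

end Weights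

/-! ### Norm estimates for iterated directional derivatives -/

section IteratedDerivatives

variable {k : ℝ≥0∞} {E : Type*} [NormedAddCommGroup E] [NormedSpace ℂ E]

theorem ExpSpace.coe_dirDeriv (a : E) (f : ExpSpace k 0 E) :
    (f.dirDeriv a : E → ℂ) = dirDerivOn Set.univ (f : E → ℂ) a := by
  change dirDerivOn (expDomain E k 0) (f : E → ℂ) a = _
  rw [expDomain_zero]

theorem ExpSpace.dirDeriv_apply (a : E) (f : ExpSpace k 0 E) (x : E) :
    (f.dirDeriv a : E → ℂ) x = fderiv ℂ (f : E → ℂ) x a := by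
  simp [ExpSpace.coe_dirDeriv, dirDerivOn]

theorem ExpSpace.iteratedFDeriv_dirDeriv (f : ExpSpace k 0 E) (a : E) (j : ℕ) (x : E)
    (v : Fin j → E) :
    iteratedFDeriv ℂ j (f.dirDeriv a : E → ℂ) x v
      = iteratedFDeriv ℂ (j + 1) (f : E → ℂ) x (Fin.snoc v a) := by
  have h : (f.dirDeriv a : E → ℂ)
      = (ContinuousLinearMap.apply ℂ ℂ a) ∘ (fun y => fderiv ℂ (f : E → ℂ) y) :=
    funext (f.dirDeriv_apply a)
  rw [iteratedFDeriv_succ_apply_right, h, ContinuousLinearMap.iteratedFDeriv_comp_left (n := j) _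
    ((f.analyticOnNhd x trivial).fderiv.contDiffAt) le_rfl]
  simp

theorem ExpSpace.dirDeriv_comm (a b : E) (f : ExpSpace k 0 E) :
    (f.dirDeriv a).dirDeriv b = (f.dirDeriv b).dirDeriv a := by
  refine ExpSpace.ext fun x => ?_
  have hd := (f.analyticOnNhd x trivial).fderiv.differentiableAt
  have h : ∀ a b : E, ((f.dirDeriv a).dirDeriv b : E → ℂ) x
      = fderiv ℂ (fderiv ℂ (f : E → ℂ)) x b a := by
    intro a b
    rw [ExpSpace.dirDeriv_apply, funext (f.dirDeriv_apply a),
      fderiv_clm_apply hd (differentiableAt_const a)]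
    simp
  rw [h, h]
  have hs : ContDiffAt ℂ ⊤ (f : E → ℂ) x := (f.analyticOnNhd x trivial).contDiffAt
  exact hs.isSymmSndFDerivAt (by simp) b a

/-- The iterated directional derivative `x ↦ dⁱf(x)(v₁, …, vᵢ)`. -/
noncomputable def ExpSpace.iterDirDeriv :
    (i : ℕ) → (Fin i → E) → ExpSpace k 0 E → ExpSpace k 0 E
  | 0, _, f => f
  | i + 1, v, f => ExpSpace.iterDirDeriv i (Fin.init v) (f.dirDeriv (v (Fin.last i)))

theorem ExpSpace.iterDirDeriv_apply (i : ℕ) : ∀ (v : Fin i → E) (f : ExpSpace k 0 E) (x : E),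
    (f.iterDirDeriv i v : E → ℂ) x = iteratedFDeriv ℂ i (f : E → ℂ) x v := by
  induction i with
  | zero => intro v f x; simp [iterDirDeriv]
  | succ i ih =>
    intro v f x
    rw [iterDirDeriv, ih, iteratedFDeriv_dirDeriv, Fin.snoc_init_self]

theorem ExpSpace.iterDirDeriv_const (i : ℕ) (x : E) : ∀ f : ExpSpace k 0 E,
    f.iterDirDeriv i (fun _ => x) = (ExpSpace.dirDeriv x)^[i] f := by
  induction i with
  | zero => intro f; rfl
  | succ i ih => intro f; exact ih _

theorem ExpSpace.taylorPoly_eq_iterate (f : ExpSpace k 0 E) (j : ℕ) (x : E) :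
    taylorPoly (f : E → ℂ) j x
      = (j.factorial : ℂ)⁻¹ * ((ExpSpace.dirDeriv x)^[j] f : ExpSpace k 0 E).1 0 := by
  rw [← iterDirDeriv_const, iterDirDeriv_apply, taylorPoly]

theorem ExpSpace.norm_iteratedFDeriv_dirDeriv_le (f : ExpSpace k 0 E) (a : E) (j : ℕ) :
    ‖iteratedFDeriv ℂ j (f.dirDeriv a : E → ℂ) 0‖
      ≤ ‖iteratedFDeriv ℂ (j + 1) (f : E → ℂ) 0‖ * ‖a‖ := by
  refine ContinuousMultilinearMap.opNorm_le_bound (by positivity) fun v => ?_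
  rw [iteratedFDeriv_dirDeriv]
  refine (ContinuousMultilinearMap.le_opNorm _ _).trans_eq ?_
  simp [Fin.prod_univ_castSucc]
  ring

theorem ExpSpace.norm_iteratedFDeriv_iterDirDeriv_le (l i : ℕ) :
    ∀ (v : Fin i → E) (f : ExpSpace k 0 E),
      ‖iteratedFDeriv ℂ l (f.iterDirDeriv i v : E → ℂ) 0‖
        ≤ ‖iteratedFDeriv ℂ (l + i) (f : E → ℂ) 0‖ * ∏ m, ‖v m‖ := by
  induction i with
  | zero => intro v f; simp [iterDirDeriv]
  | succ i ih =>
    intro v f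
    refine (ih _ _).trans ?_
    rw [Fin.prod_univ_castSucc]
    calc _ ≤ ‖iteratedFDeriv ℂ (l + i + 1) (f : E → ℂ) 0‖ * ‖v (Fin.last i)‖
          * ∏ m, ‖Fin.init v m‖ := by
          gcongr
          exact norm_iteratedFDeriv_dirDeriv_le f _ _
      _ = ‖iteratedFDeriv ℂ (l + i + 1) (f : E → ℂ) 0‖
          * ((∏ m : Fin i, ‖v m.castSucc‖) * ‖v (Fin.last i)‖) := by
          simp only [Fin.init]
          ring

/-- The binomial coefficient `(l + i)! / (l! i!)` costs `2 ^ (l + i)` and polarization costs `(2e) ^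
(l + i)`. -/
theorem ExpSpace.polyNorm_iterDirDeriv_le (l i : ℕ) (v : Fin i → E) (f : ExpSpace k 0 E) :
    (i.factorial : ℝ)⁻¹ * polyNorm (taylorPoly (f.iterDirDeriv i v : E → ℂ) l)
      ≤ (4 * Real.exp 1) ^ (l + i) * polyNorm (taylorPoly (f : E → ℂ) (l + i)) * ∏ m, ‖v m‖ := by
  have hp := polyNorm_nonneg (taylorPoly (f : E → ℂ) (l + i))
  have hl : (0 : ℝ) < l.factorial := by exact_mod_cast l.factorial_pos
  have hi : (0 : ℝ) < i.factorial := by exact_mod_cast i.factorial_pos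
  have hchoose : ((l + i).factorial : ℝ) ≤ 2 ^ (l + i) * l.factorial * i.factorial := by
    rw [← Nat.add_choose_mul_factorial_mul_factorial]
    have : (((l + i).choose i : ℕ) : ℝ) ≤ 2 ^ (l + i) := by
      exact_mod_cast Nat.choose_le_two_pow _ _
    push_cast
    gcongr
  have h0 : (0 : ℝ) ≤ ∏ m, ‖v m‖ := by positivity
  calc (i.factorial : ℝ)⁻¹ * polyNorm (taylorPoly (f.iterDirDeriv i v : E → ℂ) l)
      ≤ (i.factorial : ℝ)⁻¹ * ((l.factorial : ℝ)⁻¹ *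
          ((((l + i).factorial : ℝ) * (2 * Real.exp 1) ^ (l + i)
            * polyNorm (taylorPoly (f : E → ℂ) (l + i))) * ∏ m, ‖v m‖)) := by
        gcongr
        refine (polyNorm_le_norm_iteratedFDeriv _ l).trans ?_
        gcongr
        refine (norm_iteratedFDeriv_iterDirDeriv_le l i v f).trans ?_
        gcongr
        exact norm_iteratedFDeriv_le_polyNorm f.analyticAt_zero (l + i)
    _ ≤ (i.factorial : ℝ)⁻¹ * ((l.factorial : ℝ)⁻¹ *
          (((2 ^ (l + i) * l.factorial * i.factorial) * (2 * Real.exp 1) ^ (l + i)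
            * polyNorm (taylorPoly (f : E → ℂ) (l + i))) * ∏ m, ‖v m‖)) := by
        gcongr
    _ = _ := by
        have : (4 * Real.exp 1) ^ (l + i) = 2 ^ (l + i) * (2 * Real.exp 1) ^ (l + i) := by
          rw [← mul_pow]; ring
        rw [this]
        field_simp

/-- The basic estimate for the iterated derivatives. -/
theorem ExpSpace.expNorm_iterDirDeriv_le (hk : 1 < k) {ρ σ τ : ℝ} (hτ : 0 < τ)
    (hρ : τ * (8 * Real.exp 1) ≤ ρ) (hσ : τ * (8 * Real.exp 1) ≤ σ) (i : ℕ) (v : Fin i → E)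
    (f : ExpSpace k 0 E) :
    (σ ^ i)⁻¹ * weight k i * ((i.factorial : ℝ)⁻¹ * expNorm k ρ (f.iterDirDeriv i v : E → ℂ))
      ≤ (1 / 2) ^ i * (∏ m, ‖v m‖) * expNorm k τ (f : E → ℂ) := by
  have he := Real.exp_pos 1
  have hρ0 : 0 < ρ := lt_of_lt_of_le (by positivity) hρ
  have hσ0 : 0 < σ := lt_of_lt_of_le (by positivity) hσ
  have hs := (f.iterDirDeriv i v).summable (ρ := ρ) (by simpa using hρ0)
  have hs' := f.summable (ρ := τ) (by simpa using hτ)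
  have hshift := (summable_nat_add_iff i).mpr hs'
  -- Degree `l` of the derivative is compared with degree `l + i` of `f`. The weights combine by
  -- supermultiplicativity, and the factor `8e` between `τ` and `ρ`, `σ` absorbs `4e` and leaves
  -- powers of one half.
  have hterm : ∀ l, (σ ^ i)⁻¹ * weight k i * ((i.factorial : ℝ)⁻¹ *
      expTerm k ρ (f.iterDirDeriv i v : E → ℂ) l)
        ≤ (1 / 2) ^ i * (∏ m, ‖v m‖) * expTerm k τ (f : E → ℂ) (l + i) := by
    intro l
    have hw := weight_mul_le hk l i
    have hwl := weight_nonneg k l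
    have hwi := weight_nonneg k i
    have hwli := weight_nonneg k (l + i)
    have hp := polyNorm_nonneg (taylorPoly (f : E → ℂ) (l + i))
    have h0 : (0 : ℝ) ≤ ∏ m, ‖v m‖ := by positivity
    have hX := polyNorm_iterDirDeriv_le l i v f
    have hX0 : 0 ≤ (i.factorial : ℝ)⁻¹ * polyNorm (taylorPoly (f.iterDirDeriv i v : E → ℂ) l) :=
      mul_nonneg (by positivity) (polyNorm_nonneg _)
    unfold expTerm
    calc _ = (σ ^ i)⁻¹ * (ρ ^ l)⁻¹ * (weight k l * weight k i) * ((i.factorial : ℝ)⁻¹ *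
          polyNorm (taylorPoly (f.iterDirDeriv i v : E → ℂ) l)) := by ring
      _ ≤ ((τ * (8 * Real.exp 1)) ^ i)⁻¹ * ((τ * (8 * Real.exp 1)) ^ l)⁻¹ * weight k (l + i) *
          ((4 * Real.exp 1) ^ (l + i) * polyNorm (taylorPoly (f : E → ℂ) (l + i)) *
            ∏ m, ‖v m‖) := by
          refine mul_le_mul ?_ hX hX0 (by positivity)
          gcongr
      _ = (1 / 2) ^ (l + i) * (∏ m, ‖v m‖) * ((τ ^ (l + i))⁻¹ * weight k (l + i) *
          polyNorm (taylorPoly (f : E → ℂ) (l + i))) := by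
          have h8 : (8 * Real.exp 1) ^ (l + i) = 2 ^ (l + i) * (4 * Real.exp 1) ^ (l + i) := by
            rw [← mul_pow]; ring
          rw [← mul_inv, ← pow_add, add_comm i l, mul_pow, h8, one_div, inv_pow]
          generalize Real.exp 1 = e at *
          field_simp
      _ ≤ _ := by
          gcongr ?_ * _ * _
          exact pow_le_pow_of_le_one (by norm_num) (by norm_num) (by omega)
  unfold expNorm
  rw [← tsum_mul_left, ← tsum_mul_left]
  refine (Summable.tsum_le_tsum hterm ((hs.mul_left _).mul_left _) (hshift.mul_left _)).trans ?_
  rw [tsum_mul_left]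
  refine mul_le_mul_of_nonneg_left ?_ (by positivity)
  have := hs'.sum_add_tsum_nat_add i
  have h0 : 0 ≤ ∑ j ∈ Finset.range i, expTerm k τ (f : E → ℂ) j :=
    Finset.sum_nonneg fun j _ => expTerm_nonneg k hτ.le _ j
  linarith

/-- A version with an arbitrary radius `r` in place of the weight, used for power series converging
everywhere. It is possible because inverse weights grow at most geometrically. -/
theorem ExpSpace.exists_expNorm_iterDirDeriv_le (hk : 1 < k) {ρ r : ℝ} (hρ : 0 < ρ)
    (hr : 0 ≤ r) : ∃ τ : ℝ, 0 < τ ∧ ∀ (i : ℕ) (v : Fin i → E) (f : ExpSpace k 0 E),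
      (i.factorial : ℝ)⁻¹ * expNorm k ρ (f.iterDirDeriv i v : E → ℂ) * r ^ i
        ≤ (1 / 2) ^ i * (∏ m, ‖v m‖) * expNorm k τ (f : E → ℂ) := by
  obtain ⟨C, hC, hw⟩ := exists_inv_weight_le k
  have he := Real.exp_pos 1
  -- With this choice `r ^ i` is at most `(σ ^ i)⁻¹ * weight k i`; the added one keeps `σ` defined
  -- when `C * r = 0`.
  set σ : ℝ := (C * r + 1)⁻¹ with hσ
  have hσ0 : 0 < σ := by positivity
  refine ⟨min ρ σ / (8 * Real.exp 1), by positivity, fun i v f => ?_⟩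
  refine le_trans ?_ (expNorm_iterDirDeriv_le hk (ρ := ρ) (σ := σ)
    (τ := min ρ σ / (8 * Real.exp 1)) (by positivity) ?_ ?_ i v f)
  · rw [mul_comm _ (r ^ i)]
    have h0 : 0 ≤ expNorm k ρ (f.iterDirDeriv i v : E → ℂ) :=
      expNorm_nonneg (A := 0) (by simpa using hρ) _
    gcongr
    have hw0 := weight_pos k i
    have h1 : r ^ i * (weight k i)⁻¹ ≤ (σ ^ i)⁻¹ := by
      calc r ^ i * (weight k i)⁻¹ ≤ r ^ i * C ^ i := by gcongr; exact hw i
        _ = (C * r) ^ i := by rw [mul_pow, mul_comm]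
        _ ≤ (C * r + 1) ^ i := by gcongr; linarith
        _ = (σ ^ i)⁻¹ := by rw [hσ, inv_pow, inv_inv]
    rwa [← div_eq_mul_inv, div_le_iff₀ hw0] at h1
  · rw [div_mul_cancel₀ _ (by positivity)]; exact min_le_left _ _
  · rw [div_mul_cancel₀ _ (by positivity)]; exact min_le_right _ _

end IteratedDerivatives

/-! ### Translations and convolution with a functional -/

section Translation

variable {k : ℝ≥0∞} {E : Type*} [NormedAddCommGroup E] [NormedSpace ℂ E]

theorem expNorm_const_smul (k : ℝ≥0∞) (ρ : ℝ) {f : E → ℂ} (hf : AnalyticAt ℂ f 0) (c : ℂ) :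
    expNorm k ρ (c • f) = ‖c‖ * expNorm k ρ f := by
  unfold expNorm
  rw [tsum_congr (expTerm_const_smul k ρ hf c), tsum_mul_left]

theorem ExpSpace.summable_taylorTerms (hk : 1 < k) (f : ExpSpace k 0 E) (x : E) {ρ : ℝ}
    (hρ : 0 < ρ) : Summable fun i : ℕ =>
      expNorm k ρ ((i.factorial : ℂ)⁻¹ • f.iterDirDeriv i fun _ => x : ExpSpace k 0 E).1 := by
  obtain ⟨τ, hτ, h⟩ := exists_expNorm_iterDirDeriv_le (E := E) hk hρ (r := ‖x‖ + 1) (by positivity)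
  refine Summable.of_nonneg_of_le (fun i => expNorm_nonneg (A := 0) (by simpa using hρ) _)
    (fun i => ?_) (summable_geometric_two.mul_right (expNorm k τ (f : E → ℂ)))
  have h1 := h i (fun _ => x) f
  have h2 := expNorm_const_smul k ρ (f.iterDirDeriv i fun _ => x).analyticAt_zero
    (i.factorial : ℂ)⁻¹
  rw [norm_inv, Complex.norm_natCast] at h2
  rw [← h2] at h1
  have hK : 0 ≤ expNorm k τ (f : E → ℂ) := expNorm_nonneg (A := 0) (by simpa using hτ) _
  have hx : (0 : ℝ) < (‖x‖ + 1) ^ i := by positivity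
  refine le_of_mul_le_mul_right (h1.trans ?_) hx
  rw [Finset.prod_const, Finset.card_univ, Fintype.card_fin, mul_right_comm]
  gcongr
  linarith

/-- Derivatives in the directions `x` and `y` commute, so this is the Taylor expansion of the entire
function `D_y^j f` about the origin, evaluated at `x`. -/
theorem ExpSpace.hasSum_taylorPoly_translate (f : ExpSpace k 0 E) (x : E) (j : ℕ) (y : E) :
    HasSum (fun i : ℕ =>
      taylorPoly ((i.factorial : ℂ)⁻¹ • f.iterDirDeriv i fun _ => x : ExpSpace k 0 E).1 j y)
      (taylorPoly (fun z => (f : E → ℂ) (z + x)) j y) := by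
  have h1 : taylorPoly (fun z => (f : E → ℂ) (z + x)) j y
      = (j.factorial : ℂ)⁻¹ * ((ExpSpace.dirDeriv y)^[j] f : ExpSpace k 0 E).1 x := by
    rw [taylorPoly, iteratedFDeriv_comp_add_right, zero_add, ← iterDirDeriv_const,
      iterDirDeriv_apply]
  rw [h1]
  have h2 := (hasSum_taylorPoly
    ((ExpSpace.dirDeriv y)^[j] f : ExpSpace k 0 E).analyticOnNhd x).mul_left (j.factorial : ℂ)⁻¹
  suffices h : ∀ i : ℕ,
      taylorPoly ((i.factorial : ℂ)⁻¹ • f.iterDirDeriv i fun _ => x : ExpSpace k 0 E).1 j y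
        = (j.factorial : ℂ)⁻¹ *
          taylorPoly ((ExpSpace.dirDeriv y)^[j] f : ExpSpace k 0 E).1 i x by
    rw [funext h]
    exact h2
  intro i
  have h3 := (taylorLin k 0 j y).map_smul (i.factorial : ℂ)⁻¹ (f.iterDirDeriv i fun _ => x)
  have hcomm : Function.Commute (ExpSpace.dirDeriv (k := k) (A := 0) y) (ExpSpace.dirDeriv x) :=
    ExpSpace.dirDeriv_comm x y
  refine h3.trans ?_
  change _ * taylorPoly (f.iterDirDeriv i fun _ => x : ExpSpace k 0 E).1 j y = _
  rw [iterDirDeriv_const, taylorPoly_eq_iterate, taylorPoly_eq_iterate,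
    (hcomm.iterate_iterate j i) f]
  ring

/-- The translate `y ↦ f(y + x)` as an element of `Exp^k_{0,0}(E)`. -/
noncomputable def ExpSpace.translate (hk : 1 < k) (x : E) (f : ExpSpace k 0 E) :
    ExpSpace k 0 E :=
  ⟨fun y => (f : E → ℂ) (y + x), by simp, fun y _ =>
    AnalyticAt.fun_comp (f := fun y => y + x) (f.analyticOnNhd (y + x) trivial)
      (analyticAt_id.add analyticAt_const), fun ρ hρ =>
    (summable_expTerm_of_hasSum hρ (f.summable_taylorTerms hk x (by simpa using hρ))
      (f.hasSum_taylorPoly_translate x)).1⟩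

/-- Convergence holds in the topology of the space, not just pointwise, so continuous functionals
may be applied term by term. -/
theorem ExpSpace.hasSum_translate (hk : 1 < k) (x : E) (f : ExpSpace k 0 E) :
    HasSum (fun i : ℕ => (i.factorial : ℂ)⁻¹ • f.iterDirDeriv i fun _ => x) (f.translate hk x) :=
  ExpSpace.hasSum_of_taylorPoly (fun _ hρ => f.summable_taylorTerms hk x (by simpa using hρ))
    (f.hasSum_taylorPoly_translate x)

theorem ExpSpace.translate_translate (hk : 1 < k) (x z : E) (f : ExpSpace k 0 E) :
    (f.translate hk x).translate hk z = f.translate hk (x + z) :=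
  ExpSpace.ext fun y => congrArg f.1 (by abel)

theorem ExpSpace.translate_dirDeriv (hk : 1 < k) (x a : E) (f : ExpSpace k 0 E) :
    (f.translate hk x).dirDeriv a = (f.dirDeriv a).translate hk x := by
  refine ExpSpace.ext fun y => ?_
  change _ = (f.dirDeriv a : E → ℂ) (y + x)
  rw [dirDeriv_apply, dirDeriv_apply]
  change fderiv ℂ (fun z => (f : E → ℂ) (z + x)) y a = _
  rw [fderiv_comp_add_right]

theorem ExpSpace.exists_hasFPowerSeries_translate (hk : 1 < k) (T : ExpSpace k 0 E →L[ℂ] ℂ)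
    (f : ExpSpace k 0 E) : ∃ p : FormalMultilinearSeries ℂ E ℂ,
      HasFPowerSeriesOnBall (fun x => T (f.translate hk x)) p 0 ∞ ∧
      ∀ i v, p i v = (i.factorial : ℂ)⁻¹ * T (f.iterDirDeriv i v) := by
  obtain ⟨ρ, hρ, C, hC, hT⟩ := ExpSpace.exists_norm_le T
  have hρ0 : 0 < ρ := by simpa using hρ
  let M : ∀ i : ℕ, MultilinearMap ℂ (fun _ : Fin i => E) (ExpSpace k 0 E) := fun i =>
    { toFun := fun v => f.iterDirDeriv i v
      map_update_add' := fun v m x y => ExpSpace.ext fun z => by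
        change _ = (f.iterDirDeriv i _ : E → ℂ) z + (f.iterDirDeriv i _ : E → ℂ) z
        simp only [iterDirDeriv_apply, ContinuousMultilinearMap.map_update_add]
      map_update_smul' := fun v m c x => ExpSpace.ext fun z => by
        change _ = c * (f.iterDirDeriv i _ : E → ℂ) z
        simp only [iterDirDeriv_apply, ContinuousMultilinearMap.map_update_smul, smul_eq_mul] }
  let q : ∀ i : ℕ, MultilinearMap ℂ (fun _ : Fin i => E) ℂ := fun i =>
    ((i.factorial : ℂ)⁻¹ • (T : ExpSpace k 0 E →ₗ[ℂ] ℂ)).compMultilinearMap (M i)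
  have hq : ∀ i v, q i v = (i.factorial : ℂ)⁻¹ * T (f.iterDirDeriv i v) := fun i v => rfl
  have hqn : ∀ i v, ‖q i v‖
      ≤ C * ((i.factorial : ℝ)⁻¹ * expNorm k ρ (f.iterDirDeriv i v : E → ℂ)) := by
    intro i v
    rw [hq, norm_mul, norm_inv, Complex.norm_natCast, mul_left_comm]
    gcongr
    exact hT _
  -- The coefficients are fixed multilinear maps; only the bound depends on `r`. The value `r = 1`
  -- gives their continuity, and large `r` the infinite radius of convergence.
  have hbd : ∀ r : ℝ, 0 < r → ∃ K : ℝ, 0 ≤ K ∧ ∀ i v, ‖q i v‖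
      ≤ K * (1 / 2 / r) ^ i * ∏ m, ‖v m‖ := by
    intro r hr
    obtain ⟨τ, hτ, h⟩ := exists_expNorm_iterDirDeriv_le (E := E) hk hρ0 hr.le
    have hK : 0 ≤ expNorm k τ (f : E → ℂ) := expNorm_nonneg (A := 0) (by simpa using hτ) _
    refine ⟨C * expNorm k τ (f : E → ℂ), by positivity, fun i v => (hqn i v).trans ?_⟩
    have h1 := h i v f
    rw [← le_div_iff₀ (by positivity)] at h1
    calc _ ≤ C * ((1 / 2) ^ i * (∏ m, ‖v m‖) * expNorm k τ (f : E → ℂ) / r ^ i) := by gcongr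
      _ = _ := by rw [div_pow (1 / 2) r]; ring
  obtain ⟨K₁, hK₁, h₁⟩ := hbd 1 one_pos
  let p : FormalMultilinearSeries ℂ E ℂ := fun i => (q i).mkContinuous _ (h₁ i)
  refine ⟨p, hasFPowerSeriesOnBall_top (fun r => ?_) fun x => ?_, fun i v => rfl⟩
  · obtain ⟨K, hK, h⟩ := hbd (r + 1) (by positivity)
    refine Summable.of_nonneg_of_le (fun i => by positivity) (fun i => ?_)
      (summable_geometric_two.mul_left K)
    have hp : ‖p i‖ ≤ K * (1 / 2 / ((r : ℝ) + 1)) ^ i :=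
      ContinuousMultilinearMap.opNorm_le_bound (by positivity) (h i)
    calc ‖p i‖ * (r : ℝ) ^ i ≤ K * (1 / 2 / ((r : ℝ) + 1)) ^ i * ((r : ℝ) + 1) ^ i := by
          gcongr
          linarith
      _ = K * (1 / 2) ^ i := by
          rw [mul_assoc, ← mul_pow, div_mul_cancel₀ _ (by positivity)]
  · have := (f.hasSum_translate hk x).mapL T
    simp only [map_smul, smul_eq_mul] at this
    exact this

/-- The `i`-th Taylor polynomial is `T (D_x^i f) / i!`. The weight `weight k i` on the left of the
basic estimate is exactly the one required here, and `2` is the sum of the geometric series. -/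
theorem ExpSpace.exists_expNorm_translate_le (hk : 1 < k) (T : ExpSpace k 0 E →L[ℂ] ℂ)
    {σ : ℝ} (hσ : 0 < σ) : ∃ τ : ℝ, 0 < τ ∧ ∃ C : ℝ, 0 ≤ C ∧ ∀ f : ExpSpace k 0 E,
      Summable (expTerm k σ fun x => T (f.translate hk x)) ∧
      expNorm k σ (fun x => T (f.translate hk x)) ≤ C * expNorm k τ (f : E → ℂ) := by
  obtain ⟨ρ, hρ, C, hC, hT⟩ := ExpSpace.exists_norm_le T
  have hρ0 : 0 < ρ := by simpa using hρ
  have he := Real.exp_pos 1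
  set τ := min ρ σ / (8 * Real.exp 1) with hτ
  have hτ0 : 0 < τ := by positivity
  have hτρ : τ * (8 * Real.exp 1) ≤ ρ := by
    rw [hτ, div_mul_cancel₀ _ (by positivity)]; exact min_le_left _ _
  have hτσ : τ * (8 * Real.exp 1) ≤ σ := by
    rw [hτ, div_mul_cancel₀ _ (by positivity)]; exact min_le_right _ _
  refine ⟨τ, hτ0, C * 2, by positivity, fun f => ?_⟩
  obtain ⟨p, hp, hpT⟩ := exists_hasFPowerSeries_translate hk T f
  have hK : 0 ≤ expNorm k τ (f : E → ℂ) := expNorm_nonneg (A := 0) (by simpa using hτ0) _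
  have hle : ∀ i, expTerm k σ (fun x => T (f.translate hk x)) i
      ≤ C * expNorm k τ (f : E → ℂ) * (1 / 2) ^ i := by
    intro i
    have hc : 0 < (σ ^ i)⁻¹ * weight k i := mul_pos (by positivity) (weight_pos k i)
    unfold expTerm
    rw [← le_div_iff₀' hc]
    refine polyNorm_le fun x hx => ?_
    rw [le_div_iff₀' hc, taylorPoly_of_hasFPowerSeriesAt hp.hasFPowerSeriesAt, hpT, norm_mul,
      norm_inv, Complex.norm_natCast]
    have h := expNorm_iterDirDeriv_le hk hτ0 hτρ hτσ i (fun _ => x) f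
    have hprod : (∏ _m : Fin i, ‖x‖) ≤ 1 := by
      simpa using pow_le_one₀ (norm_nonneg x) hx
    calc _ ≤ (σ ^ i)⁻¹ * weight k i * ((i.factorial : ℝ)⁻¹ *
          (C * expNorm k ρ (f.iterDirDeriv i fun _ => x : ExpSpace k 0 E).1)) := by
          gcongr
          exact hT _
      _ = C * ((σ ^ i)⁻¹ * weight k i * ((i.factorial : ℝ)⁻¹ *
          expNorm k ρ (f.iterDirDeriv i fun _ => x : ExpSpace k 0 E).1)) := by ring
      _ ≤ C * ((1 / 2) ^ i * 1 * expNorm k τ (f : E → ℂ)) := by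
          refine mul_le_mul_of_nonneg_left (h.trans ?_) hC
          gcongr
      _ = _ := by ring
  have hg := hasSum_geometric_two.mul_left (C * expNorm k τ (f : E → ℂ))
  have hs := Summable.of_nonneg_of_le (expTerm_nonneg k hσ.le _) hle hg.summable
  exact ⟨hs, (hs.tsum_le_tsum hle hg.summable).trans_eq (by rw [hg.tsum_eq]; ring)⟩

/-- The convolution operator `f ↦ (x ↦ T (f(· + x)))` as a linear map. -/
noncomputable def convLin (hk : 1 < k) (T : ExpSpace k 0 E →L[ℂ] ℂ) :
    ExpSpace k 0 E →ₗ[ℂ] ExpSpace k 0 E where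
  toFun f := ⟨fun x => T (f.translate hk x), by simp, fun x _ => by
      obtain ⟨p, hp, -⟩ := f.exists_hasFPowerSeries_translate hk T
      exact hp.analyticOnNhd x (by simp), fun σ hσ => by
      obtain ⟨τ, -, C, -, h⟩ :=
        ExpSpace.exists_expNorm_translate_le (E := E) hk T (σ := σ) (by simpa using hσ)
      exact (h f).1⟩
  map_add' f g := ExpSpace.ext fun x => T.map_add (f.translate hk x) (g.translate hk x)
  map_smul' c f := ExpSpace.ext fun x => T.map_smul c (f.translate hk x)

/-- The convolution operator `f ↦ (x ↦ T (f(· + x)))`. -/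
noncomputable def convOp (hk : 1 < k) (T : ExpSpace k 0 E →L[ℂ] ℂ) :
    ExpSpace k 0 E →L[ℂ] ExpSpace k 0 E where
  toLinearMap := convLin hk T
  cont := by
    refine WithSeminorms.continuous_of_isBounded withSeminorms_expSeminorm withSeminorms_expSeminorm
      _ fun σ => ?_
    obtain ⟨τ, hτ, C, hC, h⟩ :=
      ExpSpace.exists_expNorm_translate_le (E := E) hk T (σ := σ.1) (by simpa using σ.2)
    refine ⟨{⟨τ, by simpa using hτ⟩}, ⟨C, hC⟩, fun f => ?_⟩
    rw [Finset.sup_singleton]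
    exact (h f).2

@[simp]
theorem convOp_apply (hk : 1 < k) (T : ExpSpace k 0 E →L[ℂ] ℂ) (f : ExpSpace k 0 E) (x : E) :
    (convOp hk T f : E → ℂ) x = T (f.translate hk x) := rfl

theorem isConvolutionOperator_convOp (hk : 1 < k) (T : ExpSpace k 0 E →L[ℂ] ℂ) :
    IsConvolutionOperator (convOp hk T) := by
  intro a f
  refine ExpSpace.ext fun x => ?_
  -- At the origin the derivative is the linear coefficient of the power series; other points are
  -- reduced to the origin by translating `f`.
  have h0 : ∀ g : ExpSpace k 0 E, fderiv ℂ (convOp hk T g : E → ℂ) 0 a = T (g.dirDeriv a) := by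
    intro g
    obtain ⟨p, hp, hpT⟩ := g.exists_hasFPowerSeries_translate hk T
    have h := taylorPoly_of_hasFPowerSeriesAt hp.hasFPowerSeriesAt 1 a
    rw [hpT, taylorPoly, iteratedFDeriv_one_apply] at h
    simp [ExpSpace.iterDirDeriv] at h
    exact h
  have h1 : fderiv ℂ (convOp hk T f : E → ℂ) x a
      = fderiv ℂ (convOp hk T (f.translate hk x) : E → ℂ) 0 a := by
    have : (convOp hk T (f.translate hk x) : E → ℂ)
        = fun z => (convOp hk T f : E → ℂ) (x + z) := by
      ext z
      rw [convOp_apply, convOp_apply, ExpSpace.translate_translate]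
    rw [this, fderiv_comp_add_left, add_zero]
  rw [ExpSpace.dirDeriv_apply, h1, h0, convOp_apply, ExpSpace.translate_dirDeriv]

/-- Evaluating the convolution operator at the origin gives back `T`. -/
theorem isNontrivial_convOp (hk : 1 < k) {T : ExpSpace k 0 E →L[ℂ] ℂ}
    (hT : ¬ ∃ c : ℂ, ∀ f : ExpSpace k 0 E, T f = c * (f : E → ℂ) 0) :
    IsNontrivial (convOp hk T) := by
  rintro ⟨c, hc⟩
  refine hT ⟨c, fun f => ?_⟩
  have h := congrArg (fun g : ExpSpace k 0 E => (g : E → ℂ) 0) (hc f)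
  have h0 : f.translate hk 0 = f := ExpSpace.ext fun y => congrArg f.1 (add_zero y)
  simp only [convOp_apply, h0] at h
  exact h

end Translation

end ConvMixing

theorem mainTheorem12 {E : Type*} [NormedAddCommGroup E] [NormedSpace ℂ E]
    [FiniteDimensional ℂ E] :
    -- nontrivial convolution operators on `Exp^k_{0,A}(E)` are mixing
    (∀ (k : ℝ≥0∞) (A : ℝ≥0), 1 < k →
      ∀ L : ConvMixing.ExpSpace k A E →L[ℂ] ConvMixing.ExpSpace k A E,
        ConvMixing.IsConvolutionOperator L → ConvMixing.IsNontrivial L →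
          ConvMixing.IsMixing L) ∧
    -- `Exp^∞_{0,0}(E) = H(E)` as topological vector spaces
    (∃ e : ConvMixing.ExpSpace ∞ 0 E ≃L[ℂ] ConvMixing.EntireSpace E,
      ∀ (f : ConvMixing.ExpSpace ∞ 0 E) (x : E), (e f : C(E, ℂ)) x = f x) ∧
    -- nontrivial convolution operators on `H(E)` are mixing and hypercyclic
    (∀ L : ConvMixing.EntireSpace E →L[ℂ] ConvMixing.EntireSpace E,
      ConvMixing.IsConvolutionOperatorEntire L → ConvMixing.IsNontrivial L →
        ConvMixing.IsMixing L ∧ ConvMixing.IsHypercyclic L) ∧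
    -- for a functional `T` which is no multiple of `δ₀`, the map `f ↦ (x ↦ T (f (· + x)))` is a
    -- nontrivial convolution operator on `Exp^k_0(E)`, and it is mixing
    (∀ k : ℝ≥0∞, 1 < k → ∀ T : ConvMixing.ExpSpace k 0 E →L[ℂ] ℂ,
      (¬ ∃ c : ℂ, ∀ f : ConvMixing.ExpSpace k 0 E, T f = c * f 0) →
        ∃ L : ConvMixing.ExpSpace k 0 E →L[ℂ] ConvMixing.ExpSpace k 0 E,
          (∀ (f : ConvMixing.ExpSpace k 0 E) (x : E), ∃ g : ConvMixing.ExpSpace k 0 E,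
            (∀ y : E, g y = f (y + x)) ∧ L f x = T g) ∧
          ConvMixing.IsConvolutionOperator L ∧ ConvMixing.IsNontrivial L ∧
          ConvMixing.IsMixing L) := by
  have : ProperSpace E := FiniteDimensional.proper ℂ E
  refine ⟨fun k A hk L hL hne => ConvMixing.isMixing_of_isConvolutionOperator hk hL hne,
    ⟨ConvMixing.entireEquiv E, fun f x => rfl⟩,
    fun L hL hne => ⟨ConvMixing.isMixing_of_isConvolutionOperatorEntire hL hne,
      ConvMixing.isHypercyclic_of_isConvolutionOperatorEntire hL hne⟩,
    fun k hk T hT => ?_⟩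
  have hconv := ConvMixing.isConvolutionOperator_convOp hk T
  have hnt := ConvMixing.isNontrivial_convOp hk hT
  exact ⟨ConvMixing.convOp hk T, fun f x => ⟨f.translate hk x, fun _ => rfl, rfl⟩, hconv, hnt,
    ConvMixing.isMixing_of_isConvolutionOperator hk hconv hnt⟩
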